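/- Let $\mathbb D$ be the open unit disk, let $n\ge 1$, let $\tau,\sigma_1,\dots,\sigma_n\in\partial\mathbb D$ be pairwise distinct, put $F=\{\sigma_1,\dots,\sigma_n\}$, and let $\Lambda=(\lambda_1,\dots,\lambda_n)\in(-\infty,0)^n$. Write $\angle\lim$ for angular (non-tangential) limits. A one-parameter semigroup is a family $(\phi_t)_{t\ge0}$ of holomorphic self-maps of $\mathbb D$ with $\phi_0=\mathrm{id}$, $\phi_{s+t}=\phi_s\circ\phi_t$ and $\phi_t(z)\to z$ as $t\to0^+$ for each $z\in\mathbb D$; its infinitesimal generator is the holomorphic function $G:\mathbb D\to\mathbb C$ with $\frac{d}{dt}\phi_t(z)=G(\phi_t(z))$ for all $z\in\mathbb D$, $t\ge0$. A point $\sigma\in\partial\mathbb D$ is a boundary regular fixed point (BRFP) of $(\phi_t)$ if for every $t\ge0$ one has $\angle\lim_{z\to\sigma}\phi_t(z)=\sigma$ and the angular derivative $\angle\lim_{z\to\sigma}\frac{\phi_t(z)-\sigma}{z-\sigma}$ exists finitely; the spectral value at $\sigma$ is then $\angle\lim_{z\to\sigma}\frac{G(z)}{\sigma-z}$. Let $\mathsf{Gen}_\tau(F,\Lambda)$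 be the set of all infinitesimal generators $G$ of one-parameter semigroups which are trivial ($G\equiv0$) or have Denjoy–Wolff point $\tau$, and which have BRFPs $\sigma_1,\dots,\sigma_n$ with spectral values $\lambda_k'$ satisfying $\lambda_k\le\lambda'_k\le0$ for $k=1,\dots,n$. Put $$\alpha_k:=\frac{|\tau-\sigma_k|^2}{2|\lambda_k|},\qquad p_0(z):=\sum_{k=1}^n\alpha_k\frac{\sigma_k+z}{\sigma_k-z},\qquad Z:=\Big\{\zeta\in\mathbb C:\Big|\Big(2\tau^{-1}\sum_{k=1}^n\alpha_k\Big)\zeta-1\Big|\le1\Big\},$$ and $\ell_\zeta:=\frac{\tau}{\zeta}-\sum_{k=1}^n\alpha_k$ for $\zeta\in Z\setminus\{0\}$. **Theorem.** For every $G\in\mathsf{Gen}_\tau(F,\Lambda)$ with $G\not\equiv0$, the angular limit $$\beta(G):=\angle\lim_{z\to\tau}\frac{(\tau-z)^3}{\tau^2G(z)}$$ exists and is a finite real number, and the value region $$W_\tau(F,\Lambda):=\big\{(G(0),\beta(G))\in\mathbb C\times\mathbb R: G\in\mathsf{Gen}_\tau(F,\Lambda),\ G\not\equiv0\big\}$$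 coincides with the set $$\big\{(\zeta,b):\zeta\in Z\setminus\{0\},\ 0\le b\le2\,\mathrm{Re}\,\ell_\zeta\big\}.$$ Moreover, for each $\zeta\in Z\setminus\{0\}$ there exists a unique $G\in\mathsf{Gen}_\tau(F,\Lambda)$ such that $G(0)=\zeta$ and $\beta(G)=2\,\mathrm{Re}\,\ell_\zeta$; it is given by $$G(z)=G_{\zeta,\tau}(z):=\frac{(\tau-z)(1-\overline\tau z)}{\frac{\tau+z}{\tau-z}\,\mathrm{Re}\,\ell_\zeta+i\,\mathrm{Im}\,\ell_\zeta+p_0(z)},\qquad z\in\mathbb D.$$ -/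

import Mathlib

open Filter Topology Set

namespace DiskSemigroup

/-- The open unit disk `𝔻` of the complex plane. -/
def disk : Set ℂ := Metric.ball (0 : ℂ) 1

/-- The Stolz region of aperture `M` at the boundary point `σ`. -/
def stolzRegion (σ : ℂ) (M : ℝ) : Set ℂ := {z | ‖z‖ < 1 ∧ ‖σ - z‖ < M * (1 - ‖z‖)}

/-- `∠lim_{z → σ} f z = l`: inside every Stolz region at `σ`, `f z` tends to the finite
number `l` as `z → σ`. -/
def HasAngularLimit (f : ℂ → ℂ) (σ l : ℂ) : Prop :=
  ∀ M : ℝ, 1 < M → Tendsto f (𝓝[stolzRegion σ M] σ) (𝓝 l)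

/-- `f` has the (finite) angular derivative `d` at its boundary fixed point `σ`. -/
def HasAngularDerivAtFixed (f : ℂ → ℂ) (σ d : ℂ) : Prop :=
  HasAngularLimit (fun z => (f z - σ) / (z - σ)) σ d

/-- `σ ∈ ∂𝔻` is a boundary regular fixed point (BRFP) of the self-map `f` of the disk. -/
def IsBRFP (f : ℂ → ℂ) (σ : ℂ) : Prop :=
  ‖σ‖ = 1 ∧ HasAngularLimit f σ σ ∧ ∃ d : ℂ, HasAngularDerivAtFixed f σ d

/-- `τ` is the Denjoy-Wolff point of the holomorphic self-map `f ≠ id` of the disk: either `τ`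
is a fixed point in the disk, with multiplier of modulus at most one, or `f` has no fixed
point in the disk and `τ` is a BRFP of `f` with angular derivative at most one. -/
def IsDWPointOfMap (f : ℂ → ℂ) (τ : ℂ) : Prop :=
  (τ ∈ disk ∧ f τ = τ ∧ ‖deriv f τ‖ ≤ 1) ∨
  ((∀ z ∈ disk, f z ≠ z) ∧ IsBRFP f τ ∧
    ∃ d : ℝ, HasAngularDerivAtFixed f τ (d : ℂ) ∧ d ≤ 1)

/-- `(φ t)`, `t ≥ 0`, is a one-parameter semigroup of holomorphic self-maps of the disk. Only
the values `φ t z` with `t ≥ 0` and `z ∈ 𝔻` matter. -/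
structure IsSemigroup (φ : ℝ → ℂ → ℂ) : Prop where
  holo : ∀ t : ℝ, 0 ≤ t → DifferentiableOn ℂ (φ t) disk
  mapsTo : ∀ t : ℝ, 0 ≤ t → MapsTo (φ t) disk disk
  zero : ∀ z ∈ disk, φ 0 z = z
  add : ∀ s t : ℝ, 0 ≤ s → 0 ≤ t → ∀ z ∈ disk, φ (s + t) z = φ s (φ t z)
  cont : ∀ z ∈ disk, Tendsto (fun t => φ t z) (𝓝[>] 0) (𝓝 z)

/-- `G` is the infinitesimal generator of `(φ t)`: it is holomorphic in the disk and
`d/dt φ_t(z) = G (φ_t(z))` for all `z ∈ 𝔻` and `t ≥ 0` (one-sided derivative at `t = 0`). -/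
def IsGenerator (φ : ℝ → ℂ → ℂ) (G : ℂ → ℂ) : Prop :=
  DifferentiableOn ℂ G disk ∧
  ∀ z ∈ disk, ∀ t : ℝ, 0 ≤ t → HasDerivWithinAt (fun s => φ s z) (G (φ t z)) (Ici 0) t

/-- The semigroup consists of the identity map only. -/
def IsTrivial (φ : ℝ → ℂ → ℂ) : Prop := ∀ t : ℝ, 0 < t → EqOn (φ t) id disk

/-- `τ` is the Denjoy-Wolff point of the non-trivial semigroup `(φ t)`: it is the Denjoy-Wolff
point of every element different from the identity. -/
def IsDWPoint (φ : ℝ → ℂ → ℂ) (τ : ℂ) : Prop :=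
  ¬ IsTrivial φ ∧ ∀ t : ℝ, 0 < t → ¬ EqOn (φ t) id disk → IsDWPointOfMap (φ t) τ

/-- `σ` is a BRFP of the semigroup `(φ t)`. -/
def IsSemigroupBRFP (φ : ℝ → ℂ → ℂ) (σ : ℂ) : Prop := ∀ t : ℝ, 0 ≤ t → IsBRFP (φ t) σ

/-- `l` is the spectral value at the BRFP `σ` of the semigroup generated by `G`. -/
def HasSpectralValue (G : ℂ → ℂ) (σ : ℂ) (l : ℝ) : Prop :=
  HasAngularLimit (fun z => G z / (σ - z)) σ (l : ℂ)

/-- The class `Gen_τ(F, Λ)`, where `F = {σ 1, …, σ n}` and `Λ = (lam 1, …, lam n)`: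
infinitesimal generators of semigroups that are trivial or have the Denjoy-Wolff point `τ`, and
that have BRFPs `σ k` with spectral values in `[lam k, 0]`. Functions on `𝔻` are
represented by functions on `ℂ` whose values outside `𝔻` are irrelevant. -/
def Gen {n : ℕ} (τ : ℂ) (σ : Fin n → ℂ) (lam : Fin n → ℝ) : Set (ℂ → ℂ) :=
  {G | ∃ φ : ℝ → ℂ → ℂ, IsSemigroup φ ∧ IsGenerator φ G ∧
    (IsTrivial φ ∨ IsDWPoint φ τ) ∧
    ∀ k, IsSemigroupBRFP φ (σ k) ∧
      ∃ l : ℝ, HasSpectralValue G (σ k) l ∧ lam k ≤ l ∧ l ≤ 0}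

/-- `β(G) = b`, i.e. `b` is the angular limit of `(τ - z)³ / (τ² G(z))` at `τ`. -/
def HasBeta (τ : ℂ) (G : ℂ → ℂ) (b : ℝ) : Prop :=
  HasAngularLimit (fun z => (τ - z) ^ 3 / (τ ^ 2 * G z)) τ (b : ℂ)

/-- The value region `W_τ(F, Λ)` of `(G(0), β(G))` over all `G ∈ Gen_τ(F, Λ)`, `G ≢ 0`. -/
def valueRegion {n : ℕ} (τ : ℂ) (σ : Fin n → ℂ) (lam : Fin n → ℝ) : Set (ℂ × ℝ) :=
  {p | ∃ G ∈ Gen τ σ lam, ¬ EqOn G 0 disk ∧ G 0 = p.1 ∧ HasBeta τ G p.2}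

noncomputable section

/-- `α_k = |τ - σ_k|² / (2 |λ_k|)`. -/
def alpha {n : ℕ} (τ : ℂ) (σ : Fin n → ℂ) (lam : Fin n → ℝ) (k : Fin n) : ℝ :=
  ‖τ - σ k‖ ^ 2 / (2 * |lam k|)

/-- `p₀(z; F, Λ) = ∑ α_k (σ_k + z) / (σ_k - z)`. -/
def pZero {n : ℕ} (τ : ℂ) (σ : Fin n → ℂ) (lam : Fin n → ℝ) (z : ℂ) : ℂ :=
  ∑ k, (alpha τ σ lam k : ℂ) * ((σ k + z) / (σ k - z))

/-- The closed disk `Z = {ζ : |(2 τ⁻¹ ∑ α_k) ζ - 1| ≤ 1}`. -/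
def diskZ {n : ℕ} (τ : ℂ) (σ : Fin n → ℂ) (lam : Fin n → ℝ) : Set ℂ :=
  {ζ | ‖(2 * τ⁻¹ * ∑ k, (alpha τ σ lam k : ℂ)) * ζ - 1‖ ≤ 1}

/-- `ℓ_ζ = τ / ζ - ∑ α_k`. -/
def ell {n : ℕ} (τ : ℂ) (σ : Fin n → ℂ) (lam : Fin n → ℝ) (ζ : ℂ) : ℂ :=
  τ / ζ - ∑ k, (alpha τ σ lam k : ℂ)

/-- The extremal function `G_{ζ,τ}`. -/
def extremalG {n : ℕ} (τ : ℂ) (σ : Fin n → ℂ) (lam : Fin n → ℝ) (ζ z : ℂ) : ℂ :=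
  (τ - z) * (1 - (starRingEnd ℂ) τ * z) /
    ((τ + z) / (τ - z) * ((ell τ σ lam ζ).re : ℂ) + Complex.I * ((ell τ σ lam ζ).im : ℂ)
      + pZero τ σ lam z)

end

end DiskSemigroup

open DiskSemigroup

namespace DiskSemigroup

/-! For a non-trivial `G` in the class, put `P(z) = (τ - z)² / (τ G(z))`. Julia's lemma at `τ` and
differentiation at `t = 0` give `Re (1/P) ≥ 0`, hence `Re P ≥ 0`. A spectral value in `[λ_k, 0]` at
`σ_k` says that the representing measure of `P` has mass at least `α_k` at `σ_k`. Splitting off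
these masses yields `P = p₀ + q` with `Re q ≥ 0` (`exists_remainder_of_mem_gen`). Since `P(0) = τ /
G(0)`, one has `q(0) = ℓ_ζ` for `ζ = G(0)`. Moreover `(τ - z)³ / (τ² G) = (τ - z) P / τ` tends to
`2m`, where `m` is the mass of `q` at `τ`. Then `0 ≤ m ≤ Re q(0)` gives the inequalities, and
equality makes `q - m · cayley τ` constant, which gives uniqueness.

Conversely, remainders `q = m · cayley τ + κ` with `0 ≤ m` and `0 ≤ Re κ` realise every admissible
pair. That the resulting `G` is in the class is `mem_gen_of_eq`: in the half-plane coordinate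
`cayley τ z` the vector field becomes `1/Q`, with `Q` rational of positive real part and explicit
primitive `H`. This `H` is injective and its image is stable under `y ↦ y + t`, so `H⁻¹(H(w) + t)`
is a global semiflow. Monotone quantities along it give the Denjoy-Wolff point and the BRFPs. No
integral representation of measures is used: masses are infima of quotients by the Poisson kernel
(`exists_boundary_mass`). -/

/-! ### Disk automorphisms and Harnack's inequality. -/

theorem mem_disk {z : ℂ} : z ∈ disk ↔ ‖z‖ < 1 := by simp [disk]

theorem one_sub_conj_mul_ne_zero {a z : ℂ} (ha : ‖a‖ < 1) (hz : ‖z‖ ≤ 1) :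
    1 - (starRingEnd ℂ) a * z ≠ 0 := by
  intro h
  have h1 : ‖(starRingEnd ℂ) a * z‖ = 1 := by
    rw [← sub_eq_zero.mp h, norm_one]
  rw [norm_mul, RCLike.norm_conj] at h1
  nlinarith [norm_nonneg a, norm_nonneg z]

theorem normSq_one_sub_conj_mul_sub (a z : ℂ) :
    ‖1 - (starRingEnd ℂ) a * z‖ ^ 2 - ‖a - z‖ ^ 2 = (1 - ‖a‖ ^ 2) * (1 - ‖z‖ ^ 2) := by
  simp only [Complex.sq_norm, Complex.normSq_apply, Complex.sub_re, Complex.sub_im,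
    Complex.mul_re, Complex.mul_im, Complex.conj_re, Complex.conj_im, Complex.one_re,
    Complex.one_im]
  ring

/-- The involutive automorphism of the disk that exchanges `0` and `a`. -/
noncomputable def diskInvolution (a z : ℂ) : ℂ := (a - z) / (1 - (starRingEnd ℂ) a * z)

theorem one_sub_normSq_diskInvolution {a z : ℂ} (ha : ‖a‖ < 1) (hz : ‖z‖ ≤ 1) :
    1 - ‖diskInvolution a z‖ ^ 2 =
      (1 - ‖a‖ ^ 2) * (1 - ‖z‖ ^ 2) / ‖1 - (starRingEnd ℂ) a * z‖ ^ 2 := by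
  have h := norm_ne_zero_iff.mpr (one_sub_conj_mul_ne_zero ha hz)
  rw [diskInvolution, norm_div, ← normSq_one_sub_conj_mul_sub, sub_div, div_self (pow_ne_zero 2 h),
    div_pow]

theorem diskInvolution_mem {a z : ℂ} (ha : ‖a‖ < 1) (hz : ‖z‖ < 1) :
    ‖diskInvolution a z‖ < 1 := by
  have h := one_sub_normSq_diskInvolution ha hz.le
  have h1 := norm_pos_iff.mpr (one_sub_conj_mul_ne_zero ha hz.le)
  have h2 : 0 < (1 - ‖a‖ ^ 2) * (1 - ‖z‖ ^ 2) / ‖1 - (starRingEnd ℂ) a * z‖ ^ 2 := by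
    apply div_pos (mul_pos _ _) (by positivity) <;> nlinarith [norm_nonneg a, norm_nonneg z]
  nlinarith [norm_nonneg (diskInvolution a z)]

theorem diskInvolution_diskInvolution {a z : ℂ} (ha : ‖a‖ < 1) (hz : ‖z‖ < 1) :
    diskInvolution a (diskInvolution a z) = z := by
  have h := one_sub_conj_mul_ne_zero ha hz.le
  have h1 := one_sub_conj_mul_ne_zero ha (diskInvolution_mem ha hz).le
  have h2 := one_sub_conj_mul_ne_zero ha ha.le
  have e1 : a - diskInvolution a z = z * (1 - (starRingEnd ℂ) a * a) /
      (1 - (starRingEnd ℂ) a * z) := by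
    rw [diskInvolution, eq_div_iff h, sub_mul, div_mul_cancel₀ _ h]; ring
  have e2 : 1 - (starRingEnd ℂ) a * diskInvolution a z = (1 - (starRingEnd ℂ) a * a) /
      (1 - (starRingEnd ℂ) a * z) := by
    rw [diskInvolution, eq_div_iff h, sub_mul, mul_assoc, div_mul_cancel₀ _ h]; ring
  conv_lhs => rw [diskInvolution]
  rw [e1, e2, div_div_div_cancel_right₀ h, mul_div_cancel_right₀ _ h2]

theorem differentiableOn_diskInvolution {a : ℂ} (ha : ‖a‖ < 1) :
    DifferentiableOn ℂ (diskInvolution a) disk := by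
  intro z hz
  have h := one_sub_conj_mul_ne_zero ha (mem_disk.mp hz).le
  unfold diskInvolution
  exact ((differentiableAt_id.const_sub a).div
    ((differentiableAt_id.const_mul _).const_sub 1) h).differentiableWithinAt

/-- Harnack's inequality for holomorphic functions with non-negative real part. -/
theorem norm_sub_le_of_re_nonneg {g : ℂ → ℂ} (hg : DifferentiableOn ℂ g disk)
    (hre : ∀ z ∈ disk, 0 ≤ (g z).re) {a z : ℂ} (ha : a ∈ disk) (hz : z ∈ disk) :
    ‖g z - g a‖ ≤ 4 * (g a).re *
      (‖1 - (starRingEnd ℂ) a * z‖ ^ 2 / ((1 - ‖a‖ ^ 2) * (1 - ‖z‖ ^ 2))) := by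
  have ha' := mem_disk.mp ha
  have hz' := mem_disk.mp hz
  set r := ‖diskInvolution a z‖ with hr
  have hr1 : r < 1 := diskInvolution_mem ha' hz'
  have hr0 : 0 ≤ r := norm_nonneg _
  -- Borel-Carathéodory is applied to `g a - g ∘ diskInvolution a`, which vanishes at `0` and has
  -- real part at most `Re g(a)`. The `ε` supplies a strictly positive bound when `Re g(a) = 0`.
  have key : ∀ ε : ℝ, 0 < ε → ‖g z - g a‖ ≤ 2 * ((g a).re + ε) * (r / (1 - r)) := by
    intro ε hε
    have h0 : diskInvolution a 0 = a := by simp [diskInvolution]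
    have hd : DifferentiableOn ℂ (fun x => g a - g (diskInvolution a x)) (Metric.ball 0 1) :=
      (hg.comp (differentiableOn_diskInvolution ha')
        (fun x hx => mem_disk.mpr (diskInvolution_mem ha' (mem_disk.mp hx)))).const_sub _
    have := Complex.borelCaratheodory_zero (M := (g a).re + ε) (R := 1)
      (z := diskInvolution a z) (by linarith [hre a ha]) hd
      (fun x hx => by
        have := hre _ (mem_disk.mpr (diskInvolution_mem ha' (mem_disk.mp hx)))
        simp only [mem_ofPred_eq, Complex.sub_re]; linarith) one_pos
      (by simpa using hr1) (by simp [h0])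
    simp only [diskInvolution_diskInvolution ha' hz'] at this
    rw [norm_sub_rev, ← mul_div_assoc]
    exact this
  have h1 : ‖g z - g a‖ ≤ 2 * (g a).re * (r / (1 - r)) := by
    have ht : Tendsto (fun ε : ℝ => 2 * ((g a).re + ε) * (r / (1 - r))) (𝓝[>] 0)
        (𝓝 (2 * ((g a).re + 0) * (r / (1 - r)))) := by
      apply Tendsto.mono_left _ nhdsWithin_le_nhds
      exact Continuous.tendsto (by fun_prop) 0
    rw [add_zero] at ht
    exact ge_of_tendsto ht (eventually_mem_nhdsWithin.mono fun ε hε => key ε hε)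
  have h2 : ‖1 - (starRingEnd ℂ) a * z‖ ^ 2 / ((1 - ‖a‖ ^ 2) * (1 - ‖z‖ ^ 2)) =
      1 / (1 - r ^ 2) := by
    rw [hr, one_sub_normSq_diskInvolution ha' hz'.le, one_div_div]
  rw [h2]
  have h3 : r / (1 - r) ≤ 2 * (1 / (1 - r ^ 2)) := by
    have : 0 < 1 - r := by linarith
    have : 0 < 1 - r ^ 2 := by nlinarith
    rw [mul_one_div, div_le_div_iff₀ (by linarith) this]
    nlinarith
  nlinarith [hre a ha]

/-- The right-hand side of Harnack's inequality is proportional to `Re g(a)`, so it vanishes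
identically. -/
theorem eqOn_const_of_re_eq_zero {g : ℂ → ℂ} (hg : DifferentiableOn ℂ g disk)
    (hre : ∀ z ∈ disk, 0 ≤ (g z).re) {a : ℂ} (ha : a ∈ disk) (h0 : (g a).re = 0) :
    ∀ z ∈ disk, g z = g a := by
  intro z hz
  have := norm_sub_le_of_re_nonneg hg hre ha hz
  rw [h0, mul_zero, zero_mul] at this
  exact sub_eq_zero.mp (norm_le_zero_iff.mp this)

/-! ### The Cayley transform and the Poisson kernel. -/

/-- The Cayley transform of the disk onto the right half-plane with pole `σ`. -/
noncomputable def cayley (σ z : ℂ) : ℂ := (σ + z) / (σ - z)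

theorem sub_ne_zero_of_mem_disk {σ z : ℂ} (hσ : ‖σ‖ = 1) (hz : z ∈ disk) : σ - z ≠ 0 := by
  intro h
  have := mem_disk.mp hz
  rw [← sub_eq_zero.mp h] at this
  linarith

theorem cayley_zero {σ : ℂ} (hσ : ‖σ‖ = 1) : cayley σ 0 = 1 := by
  have : σ ≠ 0 := by rintro rfl; simp at hσ
  simp [cayley, this]

theorem re_cayley {σ : ℂ} (hσ : ‖σ‖ = 1) (z : ℂ) :
    (cayley σ z).re = (1 - ‖z‖ ^ 2) / ‖σ - z‖ ^ 2 := by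
  have h : σ.re * σ.re + σ.im * σ.im = 1 := by
    rw [← Complex.normSq_apply, ← Complex.sq_norm, hσ]; norm_num
  rw [cayley, Complex.div_re, ← add_div, Complex.sq_norm, Complex.sq_norm]
  congr 1
  simp only [Complex.normSq_apply, Complex.sub_re, Complex.sub_im, Complex.add_re, Complex.add_im]
  linear_combination h

theorem re_cayley_pos {σ z : ℂ} (hσ : ‖σ‖ = 1) (hz : z ∈ disk) : 0 < (cayley σ z).re := by
  rw [re_cayley hσ]
  have := mem_disk.mp hz
  have h1 := norm_pos_iff.mpr (sub_ne_zero_of_mem_disk hσ hz)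
  apply div_pos _ (by positivity)
  nlinarith [norm_nonneg z]

theorem differentiableOn_cayley {σ : ℂ} (hσ : ‖σ‖ = 1) : DifferentiableOn ℂ (cayley σ) disk := by
  intro z hz
  unfold cayley
  exact ((differentiableAt_id.const_add σ).div (differentiableAt_id.const_sub σ)
    (sub_ne_zero_of_mem_disk hσ hz)).differentiableWithinAt

/-! ### Angular limits. -/

theorem stolzRegion_subset_disk (σ : ℂ) (M : ℝ) : stolzRegion σ M ⊆ disk :=
  fun _ hz => mem_disk.mpr hz.1

/-- The radius ending at `σ` lies in every Stolz region of aperture greater than `1`; this makes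
angular limits unique. -/
theorem nhdsWithin_stolzRegion_neBot {σ : ℂ} (hσ : ‖σ‖ = 1) {M : ℝ} (hM : 1 < M) :
    (𝓝[stolzRegion σ M] σ).NeBot := by
  have ht : Tendsto (fun r : ℝ => (r : ℂ) * σ) (𝓝[<] 1) (𝓝[stolzRegion σ M] σ) := by
    apply tendsto_nhdsWithin_iff.mpr ⟨_, _⟩
    · apply Tendsto.mono_left _ nhdsWithin_le_nhds
      have : Continuous (fun r : ℝ => (r : ℂ) * σ) := by fun_prop
      simpa using this.tendsto 1
    · filter_upwards [Ioo_mem_nhdsLT (zero_lt_one (α := ℝ))] with r hr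
      have h1 : ‖(r : ℂ) * σ‖ = r := by simp [hσ, abs_of_pos hr.1]
      have h2 : ‖σ - (r : ℂ) * σ‖ = 1 - r := by
        have : σ - (r : ℂ) * σ = ((1 - r : ℝ) : ℂ) * σ := by push_cast; ring
        rw [this, norm_mul, hσ, mul_one, Complex.norm_real, Real.norm_eq_abs,
          abs_of_pos (by linarith [hr.2])]
      refine ⟨by rw [h1]; exact hr.2, ?_⟩
      rw [h1, h2]
      nlinarith [hr.2]
  exact ht.neBot

theorem HasAngularLimit.unique {f : ℂ → ℂ} {σ a b : ℂ} (hσ : ‖σ‖ = 1)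
    (ha : HasAngularLimit f σ a) (hb : HasAngularLimit f σ b) : a = b :=
  haveI := nhdsWithin_stolzRegion_neBot hσ one_lt_two
  tendsto_nhds_unique (ha 2 one_lt_two) (hb 2 one_lt_two)

theorem HasAngularLimit.congr {f g : ℂ → ℂ} {σ a : ℂ} (ha : HasAngularLimit f σ a)
    (h : ∀ z ∈ disk, f z = g z) : HasAngularLimit g σ a := fun M hM =>
  (ha M hM).congr' (eventually_mem_nhdsWithin.mono fun z hz => h z (stolzRegion_subset_disk _ _ hz))

theorem HasAngularLimit.mul {f g : ℂ → ℂ} {σ a b : ℂ} (ha : HasAngularLimit f σ a)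
    (hb : HasAngularLimit g σ b) : HasAngularLimit (fun z => f z * g z) σ (a * b) :=
  fun M hM => (ha M hM).mul (hb M hM)

theorem HasAngularLimit.add {f g : ℂ → ℂ} {σ a b : ℂ} (ha : HasAngularLimit f σ a)
    (hb : HasAngularLimit g σ b) : HasAngularLimit (fun z => f z + g z) σ (a + b) :=
  fun M hM => (ha M hM).add (hb M hM)

theorem HasAngularLimit.sub {f g : ℂ → ℂ} {σ a b : ℂ} (ha : HasAngularLimit f σ a)
    (hb : HasAngularLimit g σ b) : HasAngularLimit (fun z => f z - g z) σ (a - b) :=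
  fun M hM => (ha M hM).sub (hb M hM)

theorem HasAngularLimit.inv {f : ℂ → ℂ} {σ a : ℂ} (ha : HasAngularLimit f σ a) (h : a ≠ 0) :
    HasAngularLimit (fun z => (f z)⁻¹) σ a⁻¹ := fun M hM => (ha M hM).inv₀ h

theorem hasAngularLimit_of_continuousAt {f : ℂ → ℂ} {σ : ℂ} (h : ContinuousAt f σ) :
    HasAngularLimit f σ (f σ) := fun _ _ => h.tendsto.mono_left nhdsWithin_le_nhds

/-! ### Boundary point masses and the Julia-Wolff-Carathéodory theorem. -/

/-- A function of non-negative real part that comes arbitrarily close to zero relative to the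
Poisson kernel at `σ` has no mass at `σ`. -/
theorem hasAngularLimit_zero_of_small {g : ℂ → ℂ} {σ : ℂ} (hσ : ‖σ‖ = 1)
    (hg : DifferentiableOn ℂ g disk) (hre : ∀ z ∈ disk, 0 ≤ (g z).re)
    (hsmall : ∀ ε : ℝ, 0 < ε → ∃ a ∈ disk, (g a).re ≤ ε * (cayley σ a).re) :
    HasAngularLimit (fun z => (σ - z) * g z) σ 0 := by
  intro M hM
  rw [Metric.tendsto_nhds]
  intro ε hε
  -- With this constant the Harnack bound multiplied by `|σ - z| ≤ M (1 - |z|²)` tends to `4 ·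
  -- ε/(8M) · M = ε/2`, because `|1 - conj a · σ| = |σ - a|`.
  obtain ⟨a, ha, hga⟩ := hsmall (ε / (8 * M)) (by positivity)
  have ha' := mem_disk.mp ha
  have hσa := norm_pos_iff.mpr (sub_ne_zero_of_mem_disk hσ ha)
  have ha2 : 0 < 1 - ‖a‖ ^ 2 := by nlinarith [norm_nonneg a]
  have hM0 : 0 < M := by linarith
  have hlim : Tendsto (fun z : ℂ => ‖σ - z‖ * ‖g a‖ +
      4 * (ε / (8 * M)) * M * (‖1 - (starRingEnd ℂ) a * z‖ ^ 2 / ‖σ - a‖ ^ 2))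
      (𝓝[stolzRegion σ M] σ) (𝓝 (ε / 2)) := by
    have hc : ContinuousAt (fun z : ℂ => ‖σ - z‖ * ‖g a‖ +
      4 * (ε / (8 * M)) * M * (‖1 - (starRingEnd ℂ) a * z‖ ^ 2 / ‖σ - a‖ ^ 2)) σ := by
      fun_prop
    have hv := normSq_one_sub_conj_mul_sub a σ
    rw [hσ, norm_sub_rev a σ] at hv
    have hv' : ‖1 - (starRingEnd ℂ) a * σ‖ ^ 2 = ‖σ - a‖ ^ 2 := by linarith
    have := hc.tendsto
    simp only [sub_self, norm_zero, zero_mul, zero_add, hv'] at this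
    rw [div_self (by positivity)] at this
    have e : 4 * (ε / (8 * M)) * M * 1 = ε / 2 := by field_simp; norm_num
    rw [e] at this
    exact this.mono_left nhdsWithin_le_nhds
  filter_upwards [hlim.eventually (gt_mem_nhds (half_lt_self hε)), eventually_mem_nhdsWithin]
    with z hz1 hz
  have hzd := stolzRegion_subset_disk _ _ hz
  have hz' := mem_disk.mp hzd
  have hz2 : 0 < 1 - ‖z‖ ^ 2 := by nlinarith [norm_nonneg z]
  rw [dist_zero_right, norm_mul]
  refine lt_of_le_of_lt ?_ hz1
  have h1 : ‖g z‖ ≤ ‖g a‖ + 4 * (g a).re *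
      (‖1 - (starRingEnd ℂ) a * z‖ ^ 2 / ((1 - ‖a‖ ^ 2) * (1 - ‖z‖ ^ 2))) := by
    have := norm_sub_le_of_re_nonneg hg hre ha hzd
    have h2 := norm_sub_norm_le (g z) (g a)
    linarith
  have h3 : ‖σ - z‖ ≤ M * (1 - ‖z‖ ^ 2) := by
    have := hz.2
    have h4 : 1 - ‖z‖ ≤ 1 - ‖z‖ ^ 2 := by nlinarith [norm_nonneg z]
    nlinarith
  rw [re_cayley hσ] at hga
  have h5 : 4 * (g a).re *
      (‖1 - (starRingEnd ℂ) a * z‖ ^ 2 / ((1 - ‖a‖ ^ 2) * (1 - ‖z‖ ^ 2))) ≤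
      4 * (ε / (8 * M) * ((1 - ‖a‖ ^ 2) / ‖σ - a‖ ^ 2)) *
      (‖1 - (starRingEnd ℂ) a * z‖ ^ 2 / ((1 - ‖a‖ ^ 2) * (1 - ‖z‖ ^ 2))) := by
    gcongr
  have h6 : 4 * (ε / (8 * M) * ((1 - ‖a‖ ^ 2) / ‖σ - a‖ ^ 2)) *
      (‖1 - (starRingEnd ℂ) a * z‖ ^ 2 / ((1 - ‖a‖ ^ 2) * (1 - ‖z‖ ^ 2))) =
      4 * (ε / (8 * M)) * (‖1 - (starRingEnd ℂ) a * z‖ ^ 2 / ‖σ - a‖ ^ 2) / (1 - ‖z‖ ^ 2) := by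
    field_simp
  rw [h6] at h5
  set K := 4 * (ε / (8 * M)) * (‖1 - (starRingEnd ℂ) a * z‖ ^ 2 / ‖σ - a‖ ^ 2) with hK
  have hK0 : 0 ≤ K := by positivity
  have h7 : ‖σ - z‖ * (K / (1 - ‖z‖ ^ 2)) ≤ K * M := by
    rw [mul_div_assoc', div_le_iff₀ hz2]
    nlinarith
  have h8 : 4 * (ε / (8 * M)) * M * (‖1 - (starRingEnd ℂ) a * z‖ ^ 2 / ‖σ - a‖ ^ 2) = K * M := by
    rw [hK]; ring
  rw [h8]
  calc ‖σ - z‖ * ‖g z‖ ≤ ‖σ - z‖ * (‖g a‖ + K / (1 - ‖z‖ ^ 2)) := by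
        gcongr; linarith
    _ ≤ _ := by rw [mul_add]; linarith

theorem hasAngularLimit_sub_mul_cayley {σ : ℂ} (hσ : ‖σ‖ = 1) :
    HasAngularLimit (fun z => (σ - z) * cayley σ z) σ (2 * σ) := by
  have : HasAngularLimit (fun z => σ + z) σ (σ + σ) :=
    hasAngularLimit_of_continuousAt (by fun_prop)
  rw [← two_mul] at this
  refine this.congr fun z hz => ?_
  rw [cayley, mul_div_cancel₀ _ (sub_ne_zero_of_mem_disk hσ hz)]

theorem hasAngularLimit_const (σ c : ℂ) : HasAngularLimit (fun _ => c) σ c :=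
  fun _ _ => tendsto_const_nhds

theorem hasAngularLimit_sub_mul_cayley_of_ne {σ τ : ℂ} (h : τ ≠ σ) :
    HasAngularLimit (fun z => (σ - z) * cayley τ z) σ 0 := by
  have hc : ContinuousAt (fun z => (σ - z) * cayley τ z) σ := by
    unfold cayley
    have : τ - σ ≠ 0 := sub_ne_zero.mpr h
    fun_prop (disch := assumption)
  simpa using hasAngularLimit_of_continuousAt hc

/-- The point mass at `σ` of the representing measure of a holomorphic function with
non-negative real part. -/
theorem exists_boundary_mass {h : ℂ → ℂ} {σ : ℂ} (hσ : ‖σ‖ = 1) (hd : DifferentiableOn ℂ h disk)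
    (hre : ∀ z ∈ disk, 0 ≤ (h z).re) :
    ∃ m : ℝ, 0 ≤ m ∧ HasAngularLimit (fun z => (σ - z) * h z) σ (2 * σ * m) ∧
      ∀ z ∈ disk, m * (cayley σ z).re ≤ (h z).re := by
  -- The mass is the infimum of these quotients: what remains after subtracting it is still
  -- non-negative, and is arbitrarily small relative to the Poisson kernel.
  let S : Set ℝ := (fun z => (h z).re / (cayley σ z).re) '' disk
  have hS0 : ∀ x ∈ S, 0 ≤ x := by
    rintro _ ⟨z, hz, rfl⟩
    exact div_nonneg (hre z hz) (re_cayley_pos hσ hz).le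
  have hne : S.Nonempty := ⟨_, 0, mem_disk.mpr (by simp), rfl⟩
  have hle : ∀ z ∈ disk, sInf S * (cayley σ z).re ≤ (h z).re := by
    intro z hz
    have := csInf_le ⟨0, hS0⟩ (mem_image_of_mem (fun z => (h z).re / (cayley σ z).re) hz)
    exact (le_div_iff₀ (re_cayley_pos hσ hz)).mp this
  refine ⟨sInf S, le_csInf hne hS0, ?_, hle⟩
  have h0 := hasAngularLimit_zero_of_small (g := fun z => h z - ((sInf S : ℝ) : ℂ) * cayley σ z) hσ
    (hd.sub ((differentiableOn_cayley hσ).const_mul _))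
    (fun z hz => by simpa using hle z hz) (fun ε hε => by
      obtain ⟨_, ⟨a, ha, rfl⟩, hlt⟩ := exists_lt_of_csInf_lt hne (lt_add_of_pos_right (sInf S) hε)
      refine ⟨a, ha, ?_⟩
      have := (div_lt_iff₀ (re_cayley_pos hσ ha)).mp hlt
      simp only [Complex.sub_re, Complex.re_ofReal_mul]
      linarith)
  have h1 := (hasAngularLimit_const σ ((sInf S : ℝ) : ℂ)).mul (hasAngularLimit_sub_mul_cayley hσ)
  have h2 := h0.add h1
  rw [zero_add, mul_comm] at h2
  exact h2.congr fun z _ => by ring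

theorem hasAngularLimit_id (σ : ℂ) : HasAngularLimit (fun z => σ - z) σ 0 := by
  simpa using hasAngularLimit_of_continuousAt (f := fun z => σ - z) (σ := σ) (by fun_prop)

/-- The Julia-Wolff-Carathéodory theorem at a boundary point whose horodisks are expanded by a
bounded factor. -/
theorem angularDeriv_of_horodisk_le {f : ℂ → ℂ} {σ : ℂ} (hσ : ‖σ‖ = 1)
    (hf : DifferentiableOn ℂ f disk) (hmap : MapsTo f disk disk) {c : ℝ} (hc : 0 < c)
    (hle : ∀ z ∈ disk, c * (cayley σ z).re ≤ (cayley σ (f z)).re) :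
    HasAngularLimit f σ σ ∧ ∃ d : ℝ, HasAngularDerivAtFixed f σ d ∧ d ≤ c⁻¹ := by
  have hσ0 : σ ≠ 0 := by rintro rfl; simp at hσ
  have hdiff : DifferentiableOn ℂ (fun z => cayley σ (f z) - c * cayley σ z) disk :=
    ((differentiableOn_cayley hσ).comp hf hmap).sub ((differentiableOn_cayley hσ).const_mul _)
  obtain ⟨m, hm, hlim, -⟩ := exists_boundary_mass hσ hdiff
    (fun z hz => by simpa using hle z hz)
  have h1 := (hasAngularLimit_const σ (c : ℂ)).mul (hasAngularLimit_sub_mul_cayley hσ)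
  -- Adding `1` is harmless in the limit and makes the expression `2σ / (σ - f z)`, so the
  -- difference quotient of `f` is `2σ` divided by this function. The derivative is thus the
  -- reciprocal of the total mass `m + c`.
  have h2 : HasAngularLimit (fun z => (σ - z) * (cayley σ (f z) + 1)) σ (2 * σ * (m + c : ℝ)) := by
    have := (hlim.add h1).add (hasAngularLimit_id σ)
    rw [show 2 * σ * (m : ℂ) + c * (2 * σ) + 0 = 2 * σ * (m + c : ℝ) by push_cast; ring] at this
    exact this.congr fun z _ => by ring
  have hne : 2 * σ * ((m + c : ℝ) : ℂ) ≠ 0 := by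
    have : ((m + c : ℝ) : ℂ) ≠ 0 := by exact_mod_cast (by linarith : m + c ≠ 0)
    exact mul_ne_zero (by simp [hσ0]) this
  have h3 := (hasAngularLimit_const σ (2 * σ)).mul (h2.inv hne)
  have h4 : HasAngularDerivAtFixed f σ ((m + c)⁻¹ : ℝ) := by
    have e : 2 * σ * (2 * σ * ((m + c : ℝ) : ℂ))⁻¹ = ((m + c)⁻¹ : ℝ) := by
      rw [Complex.ofReal_inv]; field_simp
    rw [e] at h3
    refine h3.congr fun z hz => ?_
    have n1 := sub_ne_zero_of_mem_disk hσ hz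
    have n2 := sub_ne_zero_of_mem_disk hσ (hmap hz)
    have n3 : z - σ ≠ 0 := by rw [← neg_sub]; exact neg_ne_zero.mpr n1
    have e2 : cayley σ (f z) + 1 = 2 * σ / (σ - f z) := by
      rw [cayley]; field_simp; ring
    rw [e2]
    field_simp
    ring
  refine ⟨?_, (m + c)⁻¹, h4, by gcongr; linarith⟩
  have h5 := (hasAngularLimit_const σ σ).sub (h4.mul (hasAngularLimit_id σ))
  rw [mul_zero, sub_zero] at h5
  refine h5.congr fun z hz => ?_
  have n1 := sub_ne_zero_of_mem_disk hσ hz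
  have n3 : z - σ ≠ 0 := by rw [← neg_sub]; exact neg_ne_zero.mpr n1
  field_simp
  ring

/-! ### From a generator to a function of non-negative real part. -/

theorem zero_mem_disk : (0 : ℂ) ∈ disk := mem_disk.mpr (by simp)

theorem IsGenerator.eqOn_zero_of_isTrivial {φ : ℝ → ℂ → ℂ} {G : ℂ → ℂ} (hφ : IsSemigroup φ)
    (hG : IsGenerator φ G) (h : IsTrivial φ) : EqOn G 0 disk := by
  intro z hz
  have h1 := hG.2 z hz 0 le_rfl
  rw [hφ.zero z hz] at h1
  have h2 : HasDerivWithinAt (fun s => φ s z) 0 (Ici 0) 0 := by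
    refine (hasDerivWithinAt_const (0 : ℝ) (Ici 0) z).congr (fun s hs => ?_) (hφ.zero z hz)
    rcases (mem_Ici.mp hs).eq_or_lt with rfl | hs
    · exact hφ.zero z hz
    · exact h s hs hz
  exact (uniqueDiffWithinAt_Ici (0 : ℝ)).eq_deriv _ h1 h2

/-- Julia's lemma: the mass `m` of `cayley τ ∘ f` at `τ` is the reciprocal of the angular derivative
`d ≤ 1`, hence at least `1`. -/
theorem IsDWPointOfMap.re_cayley_le {f : ℂ → ℂ} {τ : ℂ} (hτ : ‖τ‖ = 1)
    (hf : DifferentiableOn ℂ f disk) (hmap : MapsTo f disk disk) (h : IsDWPointOfMap f τ) {z : ℂ}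
    (hz : z ∈ disk) : (cayley τ z).re ≤ (cayley τ (f z)).re := by
  rcases h with ⟨h, -⟩ | ⟨-, ⟨-, hlim, -⟩, d, hd, hd1⟩
  · exact absurd (mem_disk.mp h) (by rw [hτ]; exact lt_irrefl 1)
  have hτ0 : τ ≠ 0 := by rintro rfl; simp at hτ
  obtain ⟨m, hm, hm1, hm2⟩ := exists_boundary_mass hτ
    ((differentiableOn_cayley hτ).comp hf hmap) (fun z hz => (re_cayley_pos hτ (hmap hz)).le)
  -- The product of `(τ - z) · cayley τ (f z)` and the difference quotient is `τ + f z`, whose limit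
  -- is `2τ`; this forces `m d = 1`.
  have h1 : HasAngularLimit (fun z => τ + f z) τ (2 * τ * m * d) := by
    refine (hm1.mul hd).congr fun z hz => ?_
    have n1 := sub_ne_zero_of_mem_disk hτ hz
    have n2 := sub_ne_zero_of_mem_disk hτ (hmap hz)
    have n3 : z - τ ≠ 0 := by rw [← neg_sub]; exact neg_ne_zero.mpr n1
    simp only [Function.comp_apply, cayley]
    field_simp
    ring
  have h2 := h1.unique hτ ((hasAngularLimit_const τ τ).add hlim)
  have h3 : m * d = 1 := by
    have : (2 * τ) * ((m : ℂ) * d) = 2 * τ * 1 := by linear_combination h2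
    exact_mod_cast mul_left_cancel₀ (by simp [hτ0]) this
  have hm3 : 1 ≤ m := by nlinarith
  have := re_cayley_pos hτ hz
  have h4 := hm2 z hz
  simp only [Function.comp_apply] at h4
  nlinarith

theorem hasDerivAt_cayley {σ z : ℂ} (h : σ - z ≠ 0) :
    HasDerivAt (cayley σ) (2 * σ / (σ - z) ^ 2) z := by
  have := ((hasDerivAt_id z).const_add σ).div ((hasDerivAt_id z).const_sub σ) h
  refine this.congr_deriv ?_
  simp only [id_eq]
  congr 1
  ring

/-- One half of the Berkson-Porta formula. -/
theorem re_generator_nonneg {φ : ℝ → ℂ → ℂ} {G : ℂ → ℂ} {τ : ℂ} (hτ : ‖τ‖ = 1)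
    (hφ : IsSemigroup φ) (hG : IsGenerator φ G) (h : IsDWPoint φ τ) {z : ℂ} (hz : z ∈ disk) :
    0 ≤ (τ * G z / (τ - z) ^ 2).re := by
  have h1 := hG.2 z hz 0 le_rfl
  have h2 : HasDerivAt (cayley τ) (2 * τ / (τ - φ 0 z) ^ 2) (φ 0 z) :=
    hasDerivAt_cayley (by rw [hφ.zero z hz]; exact sub_ne_zero_of_mem_disk hτ hz)
  have h3 := h2.comp_hasDerivWithinAt (0 : ℝ) h1
  rw [hφ.zero z hz] at h3
  have h4 := Complex.reCLM.hasFDerivAt.comp_hasDerivWithinAt (0 : ℝ) h3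
  have h5 := hasDerivWithinAt_iff_tendsto_slope.mp h4
  have h6 : 0 ≤ Complex.reCLM (2 * τ / (τ - z) ^ 2 * G z) := by
    have hsub : Ici (0 : ℝ) \ {0} = Ioi 0 := by
      ext x; simp [lt_iff_le_and_ne, eq_comm]
    rw [hsub] at h5
    refine ge_of_tendsto h5 (eventually_mem_nhdsWithin.mono fun t ht => ?_)
    have ht' : 0 < t := ht
    rw [slope_def_field, sub_zero]
    refine div_nonneg ?_ ht'.le
    simp only [Function.comp_apply, Complex.reCLM_apply, hφ.zero z hz, sub_nonneg]
    by_cases hid : EqOn (φ t) id disk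
    · rw [hid hz]; rfl
    · exact (h.2 t ht' hid).re_cayley_le hτ (hφ.holo t ht'.le) (hφ.mapsTo t ht'.le) hz
  have e : 2 * τ / (τ - z) ^ 2 * G z = ((2 : ℝ) : ℂ) * (τ * G z / (τ - z) ^ 2) := by
    push_cast; ring
  rw [e, Complex.reCLM_apply, Complex.re_ofReal_mul] at h6
  linarith

theorem re_inv_nonneg {w : ℂ} (h : 0 ≤ w.re) : 0 ≤ (w⁻¹).re := by
  rw [Complex.inv_re]; exact div_nonneg h (Complex.normSq_nonneg _)

/-- On the unit circle conjugation is inversion, so the squared distance becomes rational in `τ` and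
`σ`. -/
theorem norm_sub_sq_eq {τ σ : ℂ} (hτ : ‖τ‖ = 1) (hσ : ‖σ‖ = 1) :
    ((‖τ - σ‖ ^ 2 : ℝ) : ℂ) * (τ * σ) = -(τ - σ) ^ 2 := by
  have h1 : τ * (starRingEnd ℂ) τ = 1 := by rw [Complex.mul_conj, Complex.normSq_eq_norm_sq, hτ]; simp
  have h2 : σ * (starRingEnd ℂ) σ = 1 := by rw [Complex.mul_conj, Complex.normSq_eq_norm_sq, hσ]; simp
  rw [← Complex.normSq_eq_norm_sq, ← Complex.mul_conj, map_sub]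
  linear_combination (τ - σ) * σ * h1 - (τ - σ) * τ * h2

theorem alpha_pos {n : ℕ} {τ : ℂ} {σ : Fin n → ℂ} {lam : Fin n → ℝ} (hτσ : ∀ k, τ ≠ σ k)
    (hlam : ∀ k, lam k < 0) (k : Fin n) : 0 < alpha τ σ lam k := by
  have h1 := norm_pos_iff.mpr (sub_ne_zero.mpr (hτσ k))
  have h2 := abs_pos.mpr (hlam k).ne
  unfold alpha
  positivity

theorem pZero_eq {n : ℕ} (τ : ℂ) (σ : Fin n → ℂ) (lam : Fin n → ℝ) (z : ℂ) :
    pZero τ σ lam z = ∑ k, (alpha τ σ lam k : ℂ) * cayley (σ k) z := rfl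

theorem differentiableOn_sum_cayley {n : ℕ} {σ : Fin n → ℂ} (hσ : ∀ k, ‖σ k‖ = 1)
    (a : Fin n → ℝ) (s : Finset (Fin n)) :
    DifferentiableOn ℂ (fun z => ∑ k ∈ s, (a k : ℂ) * cayley (σ k) z) disk :=
  DifferentiableOn.fun_sum fun k _ => (differentiableOn_cayley (hσ k)).const_mul _

theorem hasAngularLimit_sub_mul_sum_cayley {n : ℕ} {σ : Fin n → ℂ} (a : Fin n → ℝ)
    (s : Finset (Fin n)) {τ : ℂ} (h : ∀ k ∈ s, σ k ≠ τ) :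
    HasAngularLimit (fun z => (τ - z) * ∑ k ∈ s, (a k : ℂ) * cayley (σ k) z) τ 0 := by
  intro M hM
  have : Tendsto (fun z => ∑ k ∈ s, (a k : ℂ) * ((τ - z) * cayley (σ k) z))
      (𝓝[stolzRegion τ M] τ) (𝓝 (∑ k ∈ s, (a k : ℂ) * 0)) :=
    tendsto_finsetSum _ fun k hk =>
      ((hasAngularLimit_sub_mul_cayley_of_ne (h k hk)) M hM).const_mul _
  simp only [mul_zero, Finset.sum_const_zero] at this
  refine this.congr fun z => ?_
  rw [Finset.mul_sum]
  exact Finset.sum_congr rfl fun k _ => by ring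

/-- Point masses at distinct boundary points can be split off simultaneously. -/
theorem re_sum_mass_le {n : ℕ} {σ : Fin n → ℂ} (hσ : ∀ k, ‖σ k‖ = 1)
    (hσinj : Function.Injective σ) {h : ℂ → ℂ} (hd : DifferentiableOn ℂ h disk)
    (hre : ∀ z ∈ disk, 0 ≤ (h z).re) {m : Fin n → ℝ}
    (hm : ∀ k, HasAngularLimit (fun z => (σ k - z) * h z) (σ k) (2 * σ k * m k))
    (s : Finset (Fin n)) : ∀ z ∈ disk, (∑ k ∈ s, (m k : ℂ) * cayley (σ k) z).re ≤ (h z).re := by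
  induction s using Finset.induction_on with
  | empty => simpa using hre
  | insert j s hj ih =>
    obtain ⟨m', -, h2, h3⟩ := exists_boundary_mass (hσ j)
      (hd.sub (differentiableOn_sum_cayley hσ m s))
      (fun z hz => by simpa using ih z hz)
    -- The Cayley transforms already subtracted are regular at `σ j`, so the mass there is
    -- unchanged.
    have h4 : HasAngularLimit (fun z => (σ j - z) * h z) (σ j) (2 * σ j * m' + 0) := by
      refine (h2.add (hasAngularLimit_sub_mul_sum_cayley (σ := σ) m s (τ := σ j) ?_)).congr
        fun z _ => ?_
      · intro k hk e
        rw [hσinj e] at hk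
        exact hj hk
      · simp only [Pi.sub_apply]; ring
    have hσ0 : σ j ≠ 0 := by intro e; have := hσ j; simp [e] at this
    have h5 := h4.unique (hσ j) (hm j)
    have h6 : m' = m j := by
      rw [add_zero] at h5
      exact_mod_cast mul_left_cancel₀ (by simp [hσ0]) h5
    intro z hz
    have h7 := h3 z hz
    rw [Finset.sum_insert hj, Complex.add_re, Complex.re_ofReal_mul, ← h6]
    simp only [Pi.sub_apply, Complex.sub_re] at h7
    linarith

/-- The reciprocal of the Berkson-Porta function of an element of the class has the point masses
of `pZero`. -/
theorem exists_remainder_of_mem_gen {n : ℕ} {τ : ℂ} {σ : Fin n → ℂ} {lam : Fin n → ℝ}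
    (hτ : ‖τ‖ = 1) (hσ : ∀ k, ‖σ k‖ = 1) (hσinj : Function.Injective σ) (hτσ : ∀ k, τ ≠ σ k)
    (hlam : ∀ k, lam k < 0) {G : ℂ → ℂ} (hG : G ∈ Gen τ σ lam) (hG0 : ¬ EqOn G 0 disk) :
    ∃ q : ℂ → ℂ, DifferentiableOn ℂ q disk ∧ (∀ z ∈ disk, 0 ≤ (q z).re) ∧
      ∀ z ∈ disk, G z ≠ 0 ∧ (τ - z) ^ 2 / (τ * G z) = pZero τ σ lam z + q z := by
  obtain ⟨φ, hφ, hgen, hdw, hspec⟩ := hG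
  have hdw' : IsDWPoint φ τ :=
    hdw.resolve_left fun h => hG0 (hgen.eqOn_zero_of_isTrivial hφ h)
  have hτ0 : τ ≠ 0 := by rintro rfl; simp at hτ
  have hp := fun z (hz : z ∈ disk) => re_generator_nonneg hτ hφ hgen hdw' hz
  have hpd : DifferentiableOn ℂ (fun z => τ * G z / (τ - z) ^ 2) disk := by
    refine (hgen.1.const_mul τ).div (by fun_prop) fun z hz => ?_
    exact pow_ne_zero 2 (sub_ne_zero_of_mem_disk hτ hz)
  have hne : ∀ z ∈ disk, G z ≠ 0 := by
    intro a ha h0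
    apply hG0
    intro z hz
    have := eqOn_const_of_re_eq_zero hpd hp ha (by simp [h0]) z hz
    simpa [h0, hτ0, sub_ne_zero_of_mem_disk hτ hz] using this
  have hre : ∀ z ∈ disk, 0 ≤ ((τ - z) ^ 2 / (τ * G z)).re := by
    intro z hz
    rw [← inv_div]
    exact re_inv_nonneg (hp z hz)
  have hd : DifferentiableOn ℂ (fun z => (τ - z) ^ 2 / (τ * G z)) disk := by
    refine DifferentiableOn.div (by fun_prop) (hgen.1.const_mul τ) fun z hz => ?_
    exact mul_ne_zero hτ0 (hne z hz)
  choose m hm0 hm1 hm2 using fun k => exists_boundary_mass (hσ k) hd hre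
  have hα : ∀ k, alpha τ σ lam k ≤ m k := by
    intro k
    obtain ⟨l, hl, hl1, hl2⟩ := (hspec k).2
    -- Multiplying the limits that define `m k` and `l` cancels `G` and gives `2 m_k l = -|τ -
    -- σ_k|²`; then `λ_k ≤ l` is `α_k ≤ m_k`.
    have h1 : HasAngularLimit (fun z => (τ - z) ^ 2 / τ) (σ k) (2 * σ k * m k * l) := by
      refine ((hm1 k).mul hl).congr fun z hz => ?_
      have n1 := sub_ne_zero_of_mem_disk (hσ k) hz
      have n2 := hne z hz
      field_simp
    have h2 : 2 * σ k * m k * l = (τ - σ k) ^ 2 / τ :=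
      h1.unique (hσ k) (hasAngularLimit_of_continuousAt (by fun_prop))
    have hσ0 : σ k ≠ 0 := by intro e; have := hσ k; simp [e] at this
    have h3 : 2 * m k * l = -‖τ - σ k‖ ^ 2 := by
      have h4 := norm_sub_sq_eq hτ (hσ k)
      rw [eq_div_iff hτ0] at h2
      have : (τ * σ k) * ((2 * m k * l : ℝ) : ℂ) = (τ * σ k) * ((-‖τ - σ k‖ ^ 2 : ℝ) : ℂ) := by
        push_cast at h4 ⊢
        linear_combination h2 + h4
      exact_mod_cast mul_left_cancel₀ (mul_ne_zero hτ0 hσ0) this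
    rw [alpha, abs_of_neg (hlam k), div_le_iff₀ (by linarith [hlam k])]
    nlinarith [hm0 k]
  refine ⟨fun z => (τ - z) ^ 2 / (τ * G z) - pZero τ σ lam z,
    hd.sub (differentiableOn_sum_cayley hσ _ _), fun z hz => ?_,
    fun z hz => ⟨hne z hz, by ring⟩⟩
  have h1 := re_sum_mass_le hσ hσinj hd hre hm1 Finset.univ z hz
  have h2 : (pZero τ σ lam z).re ≤ (∑ k, (m k : ℂ) * cayley (σ k) z).re := by
    rw [pZero_eq, Complex.re_sum, Complex.re_sum]
    refine Finset.sum_le_sum fun k _ => ?_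
    rw [Complex.re_ofReal_mul, Complex.re_ofReal_mul]
    exact mul_le_mul_of_nonneg_right (hα k) (re_cayley_pos (hσ k) hz).le
  simp only [Complex.sub_re]
  linarith

theorem pZero_zero {n : ℕ} {τ : ℂ} {σ : Fin n → ℂ} {lam : Fin n → ℝ} (hσ : ∀ k, ‖σ k‖ = 1) :
    pZero τ σ lam 0 = ∑ k, (alpha τ σ lam k : ℂ) := by
  rw [pZero_eq]
  exact Finset.sum_congr rfl fun k _ => by rw [cayley_zero (hσ k), mul_one]

/-- The poles of `pZero` lie away from `τ`, so only `q` contributes to the mass at `τ`. -/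
theorem hasBeta_of_remainder {n : ℕ} {τ : ℂ} {σ : Fin n → ℂ} {lam : Fin n → ℝ}
    (hτ : ‖τ‖ = 1) (hτσ : ∀ k, τ ≠ σ k) {G q : ℂ → ℂ}
    (hq : ∀ z ∈ disk, (τ - z) ^ 2 / (τ * G z) = pZero τ σ lam z + q z) {m : ℝ}
    (hm : HasAngularLimit (fun z => (τ - z) * q z) τ (2 * τ * m)) : HasBeta τ G (2 * m) := by
  have hτ0 : τ ≠ 0 := by rintro rfl; simp at hτ
  have h1 := ((hasAngularLimit_sub_mul_sum_cayley (alpha τ σ lam) Finset.univ (τ := τ) (σ := σ)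
    (fun k _ => (hτσ k).symm)).add hm).mul (hasAngularLimit_const τ τ⁻¹)
  have e : (0 + 2 * τ * (m : ℂ)) * τ⁻¹ = ((2 * m : ℝ) : ℂ) := by
    push_cast; field_simp; ring
  rw [e] at h1
  refine h1.congr fun z hz => ?_
  rw [← pZero_eq, ← mul_add, ← hq z hz]
  by_cases hGz : G z = 0
  · simp [hGz]
  · field_simp

theorem HasBeta.unique {τ : ℂ} (hτ : ‖τ‖ = 1) {G : ℂ → ℂ} {a b : ℝ} (ha : HasBeta τ G a)
    (hb : HasBeta τ G b) : a = b := by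
  exact_mod_cast HasAngularLimit.unique hτ ha hb

/-- The inversion `w = τ / ζ` maps this disk, which has `0` on its boundary circle, to the
half-plane `Re w ≥ ∑ α_k`. -/
theorem mem_diskZ_iff {n : ℕ} {τ : ℂ} {σ : Fin n → ℂ} {lam : Fin n → ℝ} (hτ : ‖τ‖ = 1)
    (hα : 0 < ∑ k, alpha τ σ lam k) {ζ : ℂ} (hζ : ζ ≠ 0) : ζ ∈ diskZ τ σ lam ↔ 0 ≤ (ell τ σ lam ζ).re := by
  have hτ0 : τ ≠ 0 := by rintro rfl; simp at hτ
  set A : ℝ := ∑ k, alpha τ σ lam k with hA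
  have hA' : ∑ k, (alpha τ σ lam k : ℂ) = (A : ℂ) := by rw [hA]; push_cast; rfl
  obtain ⟨w, hw⟩ : ∃ w, w = τ / ζ := ⟨_, rfl⟩
  have hw0 : w ≠ 0 := by rw [hw]; exact div_ne_zero hτ0 hζ
  have e : 2 * τ⁻¹ * (A : ℂ) * ζ - 1 = (2 * A - w) / w := by
    rw [hw]; field_simp
  rw [diskZ, mem_ofPred_eq, ell, hA', ← hw, e, norm_div, div_le_one (norm_pos_iff.mpr hw0),
    ← sq_le_sq₀ (norm_nonneg _) (norm_nonneg _), Complex.sq_norm, Complex.sq_norm]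
  simp only [Complex.normSq_apply, Complex.sub_re, Complex.sub_im, Complex.mul_re, Complex.mul_im,
    Complex.ofReal_re, Complex.ofReal_im, Complex.re_ofNat, Complex.im_ofNat]
  constructor
  · intro h
    by_contra! h'
    nlinarith
  · intro h
    nlinarith

/-! ### Linearisable semiflows of the right half-plane. -/

/-- The right half-plane. -/
def rightHalfPlane : Set ℂ := {w | 0 < w.re}

theorem isOpen_rightHalfPlane : IsOpen rightHalfPlane :=
  isOpen_lt continuous_const Complex.continuous_re

/-- `H` is a primitive of `Q` in the right half-plane, `Q'` is the derivative of `Q`, and `1 / Q` is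
a vector field with positive real part that does not expand the hyperbolic metric. -/
structure IsKoenigs (H Q Q' : ℂ → ℂ) : Prop where
  hasDerivAt : ∀ w ∈ rightHalfPlane, HasDerivAt H (Q w) w
  re_pos : ∀ w ∈ rightHalfPlane, 0 < (Q w).re
  hasDerivAt' : ∀ w ∈ rightHalfPlane, HasDerivAt Q (Q' w) w
  norm_le : ∀ w ∈ rightHalfPlane, ‖Q' w‖ * w.re ≤ (Q w).re

namespace IsKoenigs

variable {H Q Q' : ℂ → ℂ}

theorem ne_zero (h : IsKoenigs H Q Q') {w : ℂ} (hw : w ∈ rightHalfPlane) : Q w ≠ 0 := by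
  intro e
  have := h.re_pos w hw
  simp [e] at this

/-- The Noshiro-Warschawski theorem. -/
theorem injOn (h : IsKoenigs H Q Q') : InjOn H rightHalfPlane := by
  intro a ha b hb hab
  by_contra hne
  have hne' : b - a ≠ 0 := sub_ne_zero.mpr (Ne.symm hne)
  have hmem : ∀ s ∈ Icc (0 : ℝ) 1, a + s * (b - a) ∈ rightHalfPlane := by
    intro s hs
    have ha' : 0 < a.re := ha
    have hb' : 0 < b.re := hb
    show 0 < (a + s * (b - a)).re
    simp only [Complex.add_re, Complex.re_ofReal_mul, Complex.sub_re]
    nlinarith [hs.1, hs.2, mul_nonneg hs.1 hb'.le, mul_nonneg (sub_nonneg.mpr hs.2) ha'.le]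
  have hder : ∀ s ∈ Icc (0 : ℝ) 1,
      HasDerivAt (fun s : ℝ => (H (a + s * (b - a)) / (b - a)).re) (Q (a + s * (b - a))).re s := by
    intro s hs
    have h1 : HasDerivAt (fun s : ℝ => a + s * (b - a)) (b - a) s := by
      simpa using (Complex.ofRealCLM.hasDerivAt.mul_const (b - a)).const_add a (x := s)
    have h2 := ((h.hasDerivAt _ (hmem s hs)).comp s h1).div_const (b - a)
    rw [mul_div_cancel_right₀ _ hne'] at h2
    exact Complex.reCLM.hasFDerivAt.comp_hasDerivAt s h2
  have hmono := strictMonoOn_of_hasDerivWithinAt_pos (convex_Icc (0 : ℝ) 1)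
    (fun s hs => (hder s hs).continuousAt.continuousWithinAt)
    (fun s hs => (hder s (interior_subset hs)).hasDerivWithinAt)
    (fun s hs => h.re_pos _ (hmem s (interior_subset hs)))
  have := hmono (left_mem_Icc.mpr zero_le_one) (right_mem_Icc.mpr zero_le_one) zero_lt_one
  simp [hab] at this

/-- The inverse of `H` on its image. -/
noncomputable def inverse (H : ℂ → ℂ) : ℂ → ℂ := Function.invFunOn H rightHalfPlane

theorem inverse_mem {y : ℂ} (hy : y ∈ H '' rightHalfPlane) : inverse H y ∈ rightHalfPlane :=
  Function.invFunOn_mem hy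

theorem apply_inverse {y : ℂ} (hy : y ∈ H '' rightHalfPlane) : H (inverse H y) = y :=
  Function.invFunOn_eq hy

theorem inverse_apply (h : IsKoenigs H Q Q') {w : ℂ} (hw : w ∈ rightHalfPlane) :
    inverse H (H w) = w :=
  h.injOn (inverse_mem (mem_image_of_mem H hw)) hw (apply_inverse (mem_image_of_mem H hw))

theorem hasStrictDerivAt (h : IsKoenigs H Q Q') {w : ℂ} (hw : w ∈ rightHalfPlane) :
    HasStrictDerivAt H (Q w) w := by
  have hd : DifferentiableOn ℂ H rightHalfPlane :=
    fun w hw => (h.hasDerivAt w hw).differentiableAt.differentiableWithinAt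
  have := (hd.analyticAt (isOpen_rightHalfPlane.mem_nhds hw)).hasStrictDerivAt
  rwa [(h.hasDerivAt w hw).deriv] at this

theorem isOpen_image (h : IsKoenigs H Q Q') : IsOpen (H '' rightHalfPlane) := by
  rw [isOpen_iff_mem_nhds]
  rintro _ ⟨w, hw, rfl⟩
  rw [← (h.hasStrictDerivAt hw).map_nhds_eq (h.ne_zero hw)]
  exact image_mem_map (isOpen_rightHalfPlane.mem_nhds hw)

theorem hasDerivAt_inverse (h : IsKoenigs H Q Q') {y : ℂ} (hy : y ∈ H '' rightHalfPlane) :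
    HasDerivAt (inverse H) (Q (inverse H y))⁻¹ y := by
  obtain ⟨w, hw, rfl⟩ := hy
  rw [h.inverse_apply hw]
  have hs := h.hasStrictDerivAt hw
  have hg := hs.to_localInverse (h.ne_zero hw)
  refine hg.hasDerivAt.congr_of_eventuallyEq ?_
  have h0 : hs.localInverse H (Q w) w (h.ne_zero hw) (H w) = w :=
    HasStrictFDerivAt.localInverse_apply_image _
  have hc := hg.hasDerivAt.continuousAt
  rw [ContinuousAt, h0] at hc
  -- Near `H w` the local inverse takes values in the half-plane, so injectivity of `H` identifies
  -- it with `inverse H`.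
  filter_upwards [hc (isOpen_rightHalfPlane.mem_nhds hw),
    HasStrictFDerivAt.eventually_right_inverse (f := H)
      (hs.hasStrictFDerivAt_equiv (h.ne_zero hw))] with y hy1 hy2
  have := h.inverse_apply hy1
  rw [← this]
  congr 1
  exact hy2.symm

theorem hasDerivAt_trajectory (h : IsKoenigs H Q Q') {a : ℂ} {t : ℝ}
    (hmem : a + t ∈ H '' rightHalfPlane) :
    HasDerivAt (fun t : ℝ => inverse H (a + t)) (Q (inverse H (a + t)))⁻¹ t := by
  have h1 : HasDerivAt (fun s : ℝ => a + s) 1 t := by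
    simpa using Complex.ofRealCLM.hasDerivAt.const_add a (x := t)
  have h2 := (h.hasDerivAt_inverse hmem).comp t h1
  rw [mul_one] at h2
  exact h2

/-- The field `1/Q` has positive real part. This and the next two estimates assume that the
trajectory exists up to time `b`; they are the a priori bounds from which `add_mem_image` deduces
global existence. -/
theorem re_trajectory_le (h : IsKoenigs H Q Q') {w : ℂ} (hw : w ∈ rightHalfPlane) {b : ℝ}
    (hb : 0 ≤ b) (hmem : ∀ t ∈ Icc 0 b, H w + (t : ℝ) ∈ H '' rightHalfPlane) :
    w.re ≤ (inverse H (H w + b)).re := by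
  have hder := fun t ht => h.hasDerivAt_trajectory (hmem t ht)
  have hre : ∀ t ∈ Icc 0 b, HasDerivAt (fun t : ℝ => (inverse H (H w + t)).re)
      ((Q (inverse H (H w + t)))⁻¹).re t :=
    fun t ht => Complex.reCLM.hasFDerivAt.comp_hasDerivAt t (hder t ht)
  have hmono := monotoneOn_of_hasDerivWithinAt_nonneg (convex_Icc (0 : ℝ) b)
    (fun s hs => (hre s hs).continuousAt.continuousWithinAt)
    (fun s hs => (hre s (interior_subset hs)).hasDerivWithinAt)
    (fun s hs => re_inv_nonneg (h.re_pos _ (inverse_mem (hmem s (interior_subset hs)))).le)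
  simpa [h.inverse_apply hw] using hmono (left_mem_Icc.mpr hb) (right_mem_Icc.mpr hb) hb

/-- Up to a constant factor, `‖Q w‖ * w.re` is the reciprocal of the hyperbolic speed of the field
`1/Q`. The condition `norm_le` makes that speed non-increasing along trajectories. -/
theorem norm_mul_re_trajectory_le (h : IsKoenigs H Q Q') {w : ℂ} (hw : w ∈ rightHalfPlane) {b : ℝ}
    (hb : 0 ≤ b) (hmem : ∀ t ∈ Icc 0 b, H w + (t : ℝ) ∈ H '' rightHalfPlane) :
    ‖Q w‖ * w.re ≤ ‖Q (inverse H (H w + b))‖ * (inverse H (H w + b)).re := by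
  have hder := fun t ht => h.hasDerivAt_trajectory (hmem t ht)
  have hre : ∀ t ∈ Icc 0 b, HasDerivAt (fun t : ℝ => (inverse H (H w + t)).re)
      ((Q (inverse H (H w + t)))⁻¹).re t :=
    fun t ht => Complex.reCLM.hasFDerivAt.comp_hasDerivAt t (hder t ht)
  have hg := fun t ht => (((h.hasDerivAt' _ (inverse_mem (hmem t ht))).comp t (hder t ht)).norm_sq).mul
    ((hre t ht).pow 2)
  have hmono := monotoneOn_of_hasDerivWithinAt_nonneg (convex_Icc (0 : ℝ) b)
    (fun s hs => (hg s hs).continuousAt.continuousWithinAt)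
    (fun s hs => (hg s (interior_subset hs)).hasDerivWithinAt)
    (fun s hs => by
      have hs' := inverse_mem (hmem s (interior_subset hs))
      simp only [Function.comp_apply, Pi.pow_apply]
      generalize inverse H (H w + s) = v at hs'
      have hv : 0 < v.re := hs'
      have h1 := h.norm_le v hs'
      have hQ := norm_pos_iff.mpr (h.ne_zero hs')
      -- Cauchy-Schwarz, with `‖Q v‖ ‖(Q v)⁻¹‖ = 1`.
      have h2 : -‖Q' v‖ ≤ inner ℝ (Q v) (Q' v * (Q v)⁻¹) := by
        have := abs_real_inner_le_norm (Q v) (Q' v * (Q v)⁻¹)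
        rw [norm_mul, norm_inv, mul_left_comm, mul_inv_cancel₀ hQ.ne', mul_one] at this
        exact (abs_le.mp this).1
      have h3 : ‖Q v‖ ^ 2 * ((Q v)⁻¹).re = (Q v).re := by
        rw [Complex.inv_re, Complex.normSq_eq_norm_sq]; field_simp
      have h4 : 2 * inner ℝ (Q v) (Q' v * (Q v)⁻¹) * v.re ^ 2 +
          ‖Q v‖ ^ 2 * (2 * v.re * ((Q v)⁻¹).re) =
          2 * v.re * (inner ℝ (Q v) (Q' v * (Q v)⁻¹) * v.re + (Q v).re) := by
        rw [← h3]; ring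
      have h5 : 0 ≤ inner ℝ (Q v) (Q' v * (Q v)⁻¹) * v.re + (Q v).re := by nlinarith
      have h6 : 0 ≤ 2 * v.re * (inner ℝ (Q v) (Q' v * (Q v)⁻¹) * v.re + (Q v).re) := by positivity
      rw [← h4] at h6
      simpa using h6)
  have h7 := hmono (left_mem_Icc.mpr hb) (right_mem_Icc.mpr hb) hb
  have h8 : (‖Q w‖ * w.re) ^ 2 ≤
      (‖Q (inverse H (H w + b))‖ * (inverse H (H w + b)).re) ^ 2 := by
    simpa [h.inverse_apply hw, mul_pow] using h7
  have h9 : 0 < (inverse H (H w + b)).re := inverse_mem (hmem b (right_mem_Icc.mpr hb))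
  exact le_of_sq_le_sq h8 (by positivity)

/-- Monotonicity of `‖Q‖ · Re` bounds the speed `‖1/Q(v)‖` by `Re v / (‖Q w‖ Re w)`, hence by a
constant times `‖v‖`, and Gronwall's inequality applies. -/
theorem norm_trajectory_le (h : IsKoenigs H Q Q') {w : ℂ} (hw : w ∈ rightHalfPlane) {b : ℝ}
    (hb : 0 ≤ b) (hmem : ∀ t ∈ Icc 0 b, H w + (t : ℝ) ∈ H '' rightHalfPlane) :
    ‖inverse H (H w + b)‖ ≤ ‖w‖ * Real.exp ((‖Q w‖ * w.re)⁻¹ * b) := by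
  have hder := fun t ht => h.hasDerivAt_trajectory (hmem t ht)
  have hw' : 0 < w.re := hw
  have hg0 : 0 < ‖Q w‖ * w.re := mul_pos (norm_pos_iff.mpr (h.ne_zero hw)) hw'
  have := norm_le_gronwallBound_of_norm_deriv_right_le (δ := ‖w‖) (K := (‖Q w‖ * w.re)⁻¹) (ε := 0)
    (fun t ht => (hder t ht).continuousAt.continuousWithinAt)
    (fun t ht => (hder t (Ico_subset_Icc_self ht)).hasDerivWithinAt)
    (by simp [h.inverse_apply hw]) (fun t ht => by
      have ht' : ∀ s ∈ Icc 0 t, H w + (s : ℝ) ∈ H '' rightHalfPlane :=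
        fun s hs => hmem s ⟨hs.1, hs.2.trans ht.2.le⟩
      have h1 := h.norm_mul_re_trajectory_le hw ht.1 ht'
      have hv := inverse_mem (ht' t (right_mem_Icc.mpr ht.1))
      generalize inverse H (H w + t) = v at h1 hv
      have h2 := norm_pos_iff.mpr (h.ne_zero hv)
      have h3 := (le_abs_self _).trans (Complex.abs_re_le_norm v)
      rw [add_zero, norm_inv, inv_mul_eq_div, le_div_iff₀ hg0, inv_mul_eq_div, div_le_iff₀ h2]
      nlinarith) b (right_mem_Icc.mpr hb)
  rwa [gronwallBound_ε0, sub_zero] at this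

/-- The image of a Koenigs map is starlike at infinity. -/
theorem add_mem_image (h : IsKoenigs H Q Q') {w : ℂ} (hw : w ∈ rightHalfPlane) {t : ℝ}
    (ht : 0 ≤ t) : H w + t ∈ H '' rightHalfPlane := by
  by_contra hcon
  let S : Set ℝ := {t | 0 ≤ t ∧ H w + (t : ℝ) ∉ H '' rightHalfPlane}
  have hSc : IsClosed S := by
    refine isClosed_Ici.inter (h.isOpen_image.isClosed_compl.preimage ?_)
    fun_prop
  have hbdd : BddBelow S := ⟨0, fun x hx => hx.1⟩
  have hT : sInf S ∈ S := hSc.csInf_mem ⟨t, ht, hcon⟩ hbdd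
  set T := sInf S
  have hlt : ∀ s ∈ Ico 0 T, H w + (s : ℝ) ∈ H '' rightHalfPlane := by
    intro s hs
    by_contra hs'
    exact absurd (csInf_le hbdd (show s ∈ S from ⟨hs.1, hs'⟩)) (not_le.mpr hs.2)
  have hT0 : 0 < T := by
    refine lt_of_le_of_ne hT.1 fun e => hT.2 ?_
    rw [← e]
    simpa using mem_image_of_mem H hw
  -- Up to the first exit time `T` the trajectory stays in this compact subset of the open
  -- half-plane. Its image is closed, so it also contains the endpoint, a contradiction.
  let K : Set ℂ := Metric.closedBall 0 (‖w‖ * Real.exp ((‖Q w‖ * w.re)⁻¹ * T)) ∩ {v | w.re ≤ v.re}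
  have hw' : 0 < w.re := hw
  have hKsub : K ⊆ rightHalfPlane := fun v hv => lt_of_lt_of_le hw' hv.2
  have hK : IsCompact K := (isCompact_closedBall _ _).inter_right
    (isClosed_le continuous_const Complex.continuous_re)
  have hHK : IsClosed (H '' K) := (hK.image_of_continuousOn fun v hv =>
    (h.hasDerivAt v (hKsub hv)).continuousAt.continuousWithinAt).isClosed
  have hmemK : ∀ s ∈ Ico 0 T, H w + (s : ℝ) ∈ H '' K := by
    intro s hs
    have hs' : ∀ r ∈ Icc 0 s, H w + (r : ℝ) ∈ H '' rightHalfPlane :=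
      fun r hr => hlt r ⟨hr.1, hr.2.trans_lt hs.2⟩
    refine ⟨inverse H (H w + s), ⟨?_, h.re_trajectory_le hw hs.1 hs'⟩, apply_inverse (hlt s hs)⟩
    rw [mem_closedBall_zero_iff]
    refine (h.norm_trajectory_le hw hs.1 hs').trans ?_
    have := hs.2.le
    gcongr
  have hlim : Tendsto (fun s : ℝ => H w + (s : ℂ)) (𝓝[<] T) (𝓝 (H w + T)) := by
    have : Continuous (fun s : ℝ => H w + (s : ℂ)) := by fun_prop
    exact (this.tendsto T).mono_left nhdsWithin_le_nhds
  refine hT.2 (image_mono hKsub (hHK.mem_of_tendsto hlim ?_))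
  filter_upwards [Ico_mem_nhdsLT hT0] with s hs using hmemK s hs

/-- The semigroup of the right half-plane that `H` conjugates to translations. -/
noncomputable def flow (H : ℂ → ℂ) (t : ℝ) (w : ℂ) : ℂ := inverse H (H w + t)

theorem flow_mem (h : IsKoenigs H Q Q') {w : ℂ} (hw : w ∈ rightHalfPlane) {t : ℝ} (ht : 0 ≤ t) :
    flow H t w ∈ rightHalfPlane := inverse_mem (h.add_mem_image hw ht)

theorem apply_flow (h : IsKoenigs H Q Q') {w : ℂ} (hw : w ∈ rightHalfPlane) {t : ℝ} (ht : 0 ≤ t) :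
    H (flow H t w) = H w + t := apply_inverse (h.add_mem_image hw ht)

theorem flow_zero (h : IsKoenigs H Q Q') {w : ℂ} (hw : w ∈ rightHalfPlane) : flow H 0 w = w := by
  simp [flow, h.inverse_apply hw]

theorem flow_add (h : IsKoenigs H Q Q') {w : ℂ} (hw : w ∈ rightHalfPlane) {s t : ℝ} (ht : 0 ≤ t) :
    flow H (s + t) w = flow H s (flow H t w) := by
  simp only [flow]
  rw [apply_inverse (h.add_mem_image hw ht)]
  push_cast
  ring_nf

theorem flow_ne (h : IsKoenigs H Q Q') {w : ℂ} (hw : w ∈ rightHalfPlane) {t : ℝ} (ht : 0 < t) :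
    flow H t w ≠ w := by
  intro e
  have := h.apply_flow hw ht.le
  rw [e, left_eq_add] at this
  exact ht.ne' (by exact_mod_cast this)

theorem hasDerivAt_flow (h : IsKoenigs H Q Q') {w : ℂ} (hw : w ∈ rightHalfPlane) {t : ℝ}
    (ht : 0 ≤ t) : HasDerivAt (fun t => flow H t w) (Q (flow H t w))⁻¹ t :=
  h.hasDerivAt_trajectory (h.add_mem_image hw ht)

theorem differentiableAt_flow (h : IsKoenigs H Q Q') {w : ℂ} (hw : w ∈ rightHalfPlane) {t : ℝ}
    (ht : 0 ≤ t) : DifferentiableAt ℂ (flow H t) w :=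
  ((h.hasDerivAt_inverse (h.add_mem_image hw ht)).comp w
    ((h.hasDerivAt w hw).add_const (t : ℂ))).differentiableAt

theorem re_le_re_flow (h : IsKoenigs H Q Q') {w : ℂ} (hw : w ∈ rightHalfPlane) {t : ℝ}
    (ht : 0 ≤ t) : w.re ≤ (flow H t w).re :=
  h.re_trajectory_le hw ht fun _ hs => h.add_mem_image hw hs.1

/-- Horodisks at a finite boundary point at which `Q` has a point mass are expanded at most
exponentially. -/
theorem exp_mul_re_le_of_mass (h : IsKoenigs H Q Q') {A : ℝ} (hA : 0 < A) {y : ℂ} (hy : y.re = 0)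
    (hQ : ∀ v ∈ rightHalfPlane, (A * (v - y)⁻¹).re ≤ (Q v).re) {w : ℂ} (hw : w ∈ rightHalfPlane)
    {t : ℝ} (ht : 0 ≤ t) :
    Real.exp (-(A⁻¹ * t)) * ((w - y)⁻¹).re ≤ ((flow H t w - y)⁻¹).re := by
  have hne : ∀ v ∈ rightHalfPlane, v - y ≠ 0 := by
    intro v hv e
    have hv' : 0 < v.re := hv
    rw [sub_eq_zero.mp e, hy] at hv'
    exact lt_irrefl _ hv'
  have hder : ∀ s ∈ Icc 0 t, HasDerivAt (fun s => Real.exp (A⁻¹ * s) * ((flow H s w - y)⁻¹).re)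
      (Real.exp (A⁻¹ * s) * (A⁻¹ * 1) * ((flow H s w - y)⁻¹).re + Real.exp (A⁻¹ * s) *
        (-(Q (flow H s w))⁻¹ / (flow H s w - y) ^ 2).re) s := by
    intro s hs
    have h1 := ((h.hasDerivAt_flow hw hs.1).sub_const y).inv (hne _ (h.flow_mem hw hs.1))
    have h2 := Complex.reCLM.hasFDerivAt.comp_hasDerivAt s h1
    exact ((hasDerivAt_id s).const_mul A⁻¹).exp.mul h2
  have hmono := monotoneOn_of_hasDerivWithinAt_nonneg (convex_Icc (0 : ℝ) t)
    (fun s hs => (hder s hs).continuousAt.continuousWithinAt)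
    (fun s hs => (hder s (interior_subset hs)).hasDerivWithinAt)
    (fun s hs => by
      have hv := h.flow_mem hw (interior_subset hs).1
      generalize flow H s w = v at hv
      rw [mul_one, mul_assoc, ← mul_add]
      refine mul_nonneg (Real.exp_pos _).le ?_
      have n1 := hne v hv
      have n2 := h.ne_zero hv
      have h1 := hQ v hv
      have hv' : 0 < v.re := hv
      have hu : 0 ≤ ((v - y)⁻¹).re := re_inv_nonneg (by simp [hy, hv'.le])
      obtain ⟨u, hu'⟩ : ∃ u, u = (v - y)⁻¹ := ⟨_, rfl⟩
      obtain ⟨q, hq'⟩ : ∃ q, q = Q v := ⟨_, rfl⟩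
      have e : -(Q v)⁻¹ / (v - y) ^ 2 = -(u ^ 2 / q) := by
        rw [hu', hq']; field_simp
      rw [e, ← hu']
      rw [← hu', ← hq'] at h1
      rw [← hu'] at hu
      rw [← hq'] at n2
      have hn : 0 < Complex.normSq q := Complex.normSq_pos.mpr n2
      rw [Complex.neg_re, Complex.div_re, ← add_div]
      rw [← sub_eq_add_neg, sub_nonneg, inv_mul_eq_div, div_le_div_iff₀ hn hA]
      simp only [Complex.re_ofReal_mul] at h1
      simp only [pow_two, Complex.mul_re, Complex.mul_im, Complex.normSq_apply]
      -- The identity behind this is `|q|² Re u - A Re(u² conj q) = Re u · |q - A u|² + A |u|² (Re q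
      -- - A Re u)`.
      nlinarith [mul_nonneg hu (add_nonneg (sq_nonneg (q.re - A * u.re)) (sq_nonneg (q.im - A * u.im))),
        mul_nonneg hA.le (mul_nonneg (sub_nonneg.mpr h1) (add_nonneg (sq_nonneg u.re) (sq_nonneg u.im)))])
  have := hmono (left_mem_Icc.mpr ht) (right_mem_Icc.mpr ht) ht
  simp only [mul_zero, Real.exp_zero, one_mul, h.flow_zero hw] at this
  rw [Real.exp_neg, inv_mul_le_iff₀ (Real.exp_pos _)]
  exact this

end IsKoenigs

/-! ### Rational Herglotz functions. -/

/-- A half-plane function of non-negative real part with finitely many point masses. -/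
noncomputable def rationalHerglotz {n : ℕ} (μ : ℝ) (κ : ℂ) (A : Fin n → ℝ) (y : Fin n → ℂ) (w : ℂ) : ℂ :=
  μ * w + κ + ∑ k, A k * (w - y k)⁻¹

theorem re_sub_pos {w y : ℂ} (hw : w ∈ rightHalfPlane) (hy : y.re = 0) : 0 < (w - y).re := by
  have : 0 < w.re := hw
  simpa [hy] using this

theorem re_inv_sub {w y : ℂ} (hy : y.re = 0) : ((w - y)⁻¹).re = ‖w - y‖⁻¹ ^ 2 * w.re := by
  rw [Complex.inv_re, Complex.normSq_eq_norm_sq, Complex.sub_re, hy, sub_zero, inv_pow,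
    div_eq_inv_mul]

/-- The derivative bound, a Schwarz-Pick inequality, holds term by term because `Re (w - y)⁻¹ = Re w
/ |w - y|²` for imaginary `y`. Each `w - y k` is in the right half-plane, so the principal logarithm
is holomorphic there. -/
theorem isKoenigs_rationalHerglotz {n : ℕ} (hn : 1 ≤ n) {μ : ℝ} (hμ : 0 ≤ μ) {κ : ℂ}
    (hκ : 0 ≤ κ.re) {A : Fin n → ℝ} (hA : ∀ k, 0 < A k) {y : Fin n → ℂ} (hy : ∀ k, (y k).re = 0) :
    IsKoenigs (fun w => μ * (w ^ 2 / 2) + κ * w + ∑ k, A k * Complex.log (w - y k))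
      (rationalHerglotz μ κ A y)
      (fun w => μ - ∑ k, A k * ((w - y k)⁻¹) ^ 2) := by
  have hne : ∀ w ∈ rightHalfPlane, ∀ k, w - y k ≠ 0 := by
    intro w hw k e
    have := re_sub_pos hw (hy k)
    simp [e] at this
  have hre : ∀ w, (rationalHerglotz μ κ A y w).re =
      μ * w.re + κ.re + ∑ k, A k * (‖w - y k‖⁻¹ ^ 2 * w.re) := by
    intro w
    simp only [rationalHerglotz, Complex.add_re, Complex.re_ofReal_mul, Complex.re_sum,
      re_inv_sub (hy _)]
  constructor
  · intro w hw
    have h1 : HasDerivAt (fun w : ℂ => w ^ 2 / 2) w w := by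
      simpa using (hasDerivAt_pow 2 w).div_const 2
    have h2 : HasDerivAt (fun w => ∑ k, A k * Complex.log (w - y k))
        (∑ k, A k * (w - y k)⁻¹) w := by
      refine HasDerivAt.fun_sum fun k _ => ?_
      have := ((hasDerivAt_id w).sub_const (y k)).clog (Or.inl (re_sub_pos hw (hy k)))
      simpa using this.const_mul (A k : ℂ)
    have h3 := ((h1.const_mul (μ : ℂ)).add ((hasDerivAt_id w).const_mul κ)).add h2
    rw [mul_one] at h3
    exact h3
  · intro w hw
    have hw' : 0 < w.re := hw
    rw [hre]
    have : 0 < ∑ k, A k * (‖w - y k‖⁻¹ ^ 2 * w.re) := by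
      refine Finset.sum_pos (fun k _ => ?_) ⟨⟨0, hn⟩, Finset.mem_univ _⟩
      have := norm_pos_iff.mpr (hne w hw k)
      have := hA k
      positivity
    positivity
  · intro w hw
    have h2 : HasDerivAt (fun w => ∑ k, A k * (w - y k)⁻¹)
        (∑ k, A k * -((w - y k)⁻¹) ^ 2) w := by
      refine HasDerivAt.fun_sum fun k _ => ?_
      have := ((hasDerivAt_id w).sub_const (y k)).inv (hne w hw k)
      rw [neg_div, one_div, ← inv_pow] at this
      exact this.const_mul (A k : ℂ)
    have h3 := (((hasDerivAt_id w).const_mul (μ : ℂ)).add_const κ).add h2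
    simp only [mul_one, mul_neg, Finset.sum_neg_distrib, ← sub_eq_add_neg] at h3
    exact h3
  · intro w hw
    have hw' : 0 < w.re := hw
    have h1 : ‖(μ : ℂ) - ∑ k, A k * ((w - y k)⁻¹) ^ 2‖ ≤ μ + ∑ k, A k * ‖w - y k‖⁻¹ ^ 2 := by
      refine (norm_sub_le _ _).trans (add_le_add ?_ ((norm_sum_le _ _).trans
        (Finset.sum_le_sum fun k _ => ?_)))
      · simp [abs_of_nonneg hμ]
      · simp [abs_of_pos (hA k)]
    rw [hre]
    refine (mul_le_mul_of_nonneg_right h1 hw'.le).trans ?_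
    rw [add_mul, Finset.sum_mul]
    simp only [mul_assoc]
    linarith

/-! ### Transfer of flows to the disk. -/

theorem ne_zero_of_norm_eq_one {τ : ℂ} (hτ : ‖τ‖ = 1) : τ ≠ 0 := by rintro rfl; simp at hτ

/-- The inverse of `cayley τ`. -/
noncomputable def cayleyInv (τ w : ℂ) : ℂ := τ * (w - 1) / (w + 1)

theorem add_one_ne_zero_of_mem {w : ℂ} (hw : w ∈ rightHalfPlane) : w + 1 ≠ 0 := by
  intro e
  have hw' : 0 < w.re := hw
  have := congrArg Complex.re e
  simp at this
  linarith

theorem cayleyInv_mem {τ w : ℂ} (hτ : ‖τ‖ = 1) (hw : w ∈ rightHalfPlane) :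
    cayleyInv τ w ∈ disk := by
  have hw' : 0 < w.re := hw
  rw [mem_disk, cayleyInv, norm_div, norm_mul, hτ, one_mul,
    div_lt_one (norm_pos_iff.mpr (add_one_ne_zero_of_mem hw)),
    ← sq_lt_sq₀ (norm_nonneg _) (norm_nonneg _), Complex.sq_norm, Complex.sq_norm]
  simp only [Complex.normSq_apply, Complex.sub_re, Complex.sub_im, Complex.add_re, Complex.add_im,
    Complex.one_re, Complex.one_im]
  nlinarith

theorem cayley_cayleyInv {τ w : ℂ} (hτ : τ ≠ 0) (hw : w + 1 ≠ 0) :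
    cayley τ (cayleyInv τ w) = w := by
  have e1 : τ + cayleyInv τ w = 2 * τ * w / (w + 1) := by rw [cayleyInv]; field_simp; ring
  have e2 : τ - cayleyInv τ w = 2 * τ / (w + 1) := by rw [cayleyInv]; field_simp; ring
  rw [cayley, e1, e2]
  field_simp

theorem cayleyInv_cayley {τ z : ℂ} (hτ : τ ≠ 0) (hz : τ - z ≠ 0) :
    cayleyInv τ (cayley τ z) = z := by
  have e1 : cayley τ z - 1 = 2 * z / (τ - z) := by rw [cayley]; field_simp; ring
  have e2 : cayley τ z + 1 = 2 * τ / (τ - z) := by rw [cayley]; field_simp; ring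
  rw [cayleyInv, e1, e2]
  field_simp

theorem hasDerivAt_cayleyInv {τ w : ℂ} (hτ : τ ≠ 0) (hw : w + 1 ≠ 0) :
    HasDerivAt (cayleyInv τ) ((τ - cayleyInv τ w) ^ 2 / (2 * τ)) w := by
  have := (((hasDerivAt_id w).sub_const 1).const_mul τ).div ((hasDerivAt_id w).add_const 1) hw
  refine this.congr_deriv ?_
  have e2 : τ - cayleyInv τ w = 2 * τ / (w + 1) := by rw [cayleyInv]; field_simp; ring
  rw [e2]
  simp only [id_eq]
  field_simp
  ring

/-- The Cayley transform with pole `σ` in terms of the one with pole `τ`. -/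
theorem cayley_eq_inv_sub {τ σ z : ℂ} (hτ : ‖τ‖ = 1) (hσ : ‖σ‖ = 1) (hne : τ ≠ σ)
    (hz : z ∈ disk) : cayley σ z =
      ((4 / ‖τ - σ‖ ^ 2 : ℝ) : ℂ) * (cayley τ z - cayley τ σ)⁻¹ - cayley τ σ := by
  have n1 := sub_ne_zero_of_mem_disk hτ hz
  have n2 := sub_ne_zero_of_mem_disk hσ hz
  have n3 := sub_ne_zero.mpr hne
  have n4 := ne_zero_of_norm_eq_one hτ
  have n5 := ne_zero_of_norm_eq_one hσ
  have h1 : ((‖τ - σ‖ ^ 2 : ℝ) : ℂ) = -(τ - σ) ^ 2 / (τ * σ) := by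
    rw [eq_div_iff (mul_ne_zero n4 n5)]; exact norm_sub_sq_eq hτ hσ
  have h2 : cayley τ z - cayley τ σ = -(2 * τ * (σ - z)) / ((τ - z) * (τ - σ)) := by
    rw [cayley, cayley]; field_simp; ring
  rw [Complex.ofReal_div, h1, h2, cayley, cayley]
  push_cast
  field_simp
  ring

theorem re_cayley_boundary {τ σ : ℂ} (hτ : ‖τ‖ = 1) (hσ : ‖σ‖ = 1) : (cayley τ σ).re = 0 := by
  rw [re_cayley hτ, hσ]; simp

theorem re_cayley_eq_inv_sub {τ σ z : ℂ} (hτ : ‖τ‖ = 1) (hσ : ‖σ‖ = 1) (hne : τ ≠ σ)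
    (hz : z ∈ disk) : (cayley σ z).re =
      4 / ‖τ - σ‖ ^ 2 * ((cayley τ z - cayley τ σ)⁻¹).re := by
  rw [cayley_eq_inv_sub hτ hσ hne hz, Complex.sub_re, Complex.re_ofReal_mul,
    re_cayley_boundary hτ hσ, sub_zero]

/-- A flow of the right half-plane, transferred to the disk. -/
noncomputable def diskFlow (τ : ℂ) (H : ℂ → ℂ) (t : ℝ) (z : ℂ) : ℂ :=
  cayleyInv τ (IsKoenigs.flow H t (cayley τ z))

section

variable {H Q Q' : ℂ → ℂ} {τ : ℂ}

theorem cayley_mem {z : ℂ} (hτ : ‖τ‖ = 1) (hz : z ∈ disk) : cayley τ z ∈ rightHalfPlane :=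
  re_cayley_pos hτ hz

theorem diskFlow_mem (h : IsKoenigs H Q Q') (hτ : ‖τ‖ = 1) {t : ℝ} (ht : 0 ≤ t) {z : ℂ}
    (hz : z ∈ disk) : diskFlow τ H t z ∈ disk :=
  cayleyInv_mem hτ (h.flow_mem (cayley_mem hτ hz) ht)

theorem cayley_diskFlow (h : IsKoenigs H Q Q') (hτ : ‖τ‖ = 1) {t : ℝ} (ht : 0 ≤ t) {z : ℂ}
    (hz : z ∈ disk) : cayley τ (diskFlow τ H t z) = IsKoenigs.flow H t (cayley τ z) :=
  cayley_cayleyInv (ne_zero_of_norm_eq_one hτ)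
    (add_one_ne_zero_of_mem (h.flow_mem (cayley_mem hτ hz) ht))

theorem hasDerivAt_diskFlow (h : IsKoenigs H Q Q') (hτ : ‖τ‖ = 1) {t : ℝ} (ht : 0 ≤ t) {z : ℂ}
    (hz : z ∈ disk) : HasDerivAt (fun t => diskFlow τ H t z)
      ((τ - diskFlow τ H t z) ^ 2 / (2 * τ) * (Q (cayley τ (diskFlow τ H t z)))⁻¹) t := by
  rw [cayley_diskFlow h hτ ht hz]
  exact (hasDerivAt_cayleyInv (ne_zero_of_norm_eq_one hτ)
    (add_one_ne_zero_of_mem (h.flow_mem (cayley_mem hτ hz) ht))).comp t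
    (h.hasDerivAt_flow (cayley_mem hτ hz) ht)

theorem isSemigroup_diskFlow (h : IsKoenigs H Q Q') (hτ : ‖τ‖ = 1) :
    IsSemigroup (diskFlow τ H) := by
  have hτ0 := ne_zero_of_norm_eq_one hτ
  have hzero : ∀ z ∈ disk, diskFlow τ H 0 z = z := fun z hz => by
    rw [diskFlow, h.flow_zero (cayley_mem hτ hz),
      cayleyInv_cayley hτ0 (sub_ne_zero_of_mem_disk hτ hz)]
  refine ⟨fun t ht z hz => ?_, fun t ht z hz => diskFlow_mem h hτ ht hz, hzero,
    fun s t hs ht z hz => ?_, fun z hz => ?_⟩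
  · have hw := cayley_mem hτ hz
    have h1 := ((h.differentiableAt_flow hw ht).comp z
      (hasDerivAt_cayley (sub_ne_zero_of_mem_disk hτ hz)).differentiableAt)
    exact ((hasDerivAt_cayleyInv hτ0
      (add_one_ne_zero_of_mem (h.flow_mem hw ht))).differentiableAt.comp z h1).differentiableWithinAt
  · have e := cayley_diskFlow h hτ ht hz
    rw [diskFlow, h.flow_add (cayley_mem hτ hz) ht, ← e, ← diskFlow]
  · have h1 := (hasDerivAt_diskFlow h hτ le_rfl hz).continuousAt.tendsto
    rw [hzero z hz] at h1
    exact h1.mono_left nhdsWithin_le_nhds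

theorem diskFlow_ne (h : IsKoenigs H Q Q') (hτ : ‖τ‖ = 1) {t : ℝ} (ht : 0 < t) {z : ℂ}
    (hz : z ∈ disk) : diskFlow τ H t z ≠ z := by
  intro e
  have := cayley_diskFlow h hτ ht.le hz
  rw [e] at this
  exact h.flow_ne (cayley_mem hτ hz) ht this.symm

/-- Conjugation to a translation excludes fixed points, and growth of the real part in the
half-plane means that horodisks at `τ` are preserved, whence angular derivative at most `1`. -/
theorem isDWPoint_diskFlow (h : IsKoenigs H Q Q') (hτ : ‖τ‖ = 1) :
    IsDWPoint (diskFlow τ H) τ := by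
  have hsg := isSemigroup_diskFlow h hτ
  refine ⟨fun ht => diskFlow_ne h hτ one_pos zero_mem_disk (ht 1 one_pos zero_mem_disk),
    fun t ht _ => Or.inr ⟨fun z hz => diskFlow_ne h hτ ht hz, ?_⟩⟩
  obtain ⟨h1, d, h2, h3⟩ := angularDeriv_of_horodisk_le hτ (hsg.holo t ht.le)
    (hsg.mapsTo t ht.le) one_pos (fun z hz => by
      rw [one_mul, cayley_diskFlow h hτ ht.le hz]
      exact h.re_le_re_flow (cayley_mem hτ hz) ht.le)
  exact ⟨⟨hτ, h1, d, h2⟩, d, h2, by simpa using h3⟩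

theorem isSemigroupBRFP_diskFlow (h : IsKoenigs H Q Q') (hτ : ‖τ‖ = 1) {σ : ℂ} (hσ : ‖σ‖ = 1)
    (hne : τ ≠ σ) {A : ℝ} (hA : 0 < A)
    (hQ : ∀ v ∈ rightHalfPlane, (A * (v - cayley τ σ)⁻¹).re ≤ (Q v).re) :
    IsSemigroupBRFP (diskFlow τ H) σ := by
  intro t ht
  have hsg := isSemigroup_diskFlow h hτ
  obtain ⟨h1, d, h2, -⟩ := angularDeriv_of_horodisk_le hσ (hsg.holo t ht)
    (hsg.mapsTo t ht) (Real.exp_pos (-(A⁻¹ * t))) (fun z hz => by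
      rw [re_cayley_eq_inv_sub hτ hσ hne hz,
        re_cayley_eq_inv_sub hτ hσ hne (diskFlow_mem h hτ ht hz), cayley_diskFlow h hτ ht hz,
        mul_left_comm]
      exact mul_le_mul_of_nonneg_left
        (h.exp_mul_re_le_of_mass hA (re_cayley_boundary hτ hσ) hQ (cayley_mem hτ hz) ht)
        (by positivity))
  exact ⟨hσ, h1, d, h2⟩

end

/-! ### Generators with remainder `μ · cayley τ + κ`. -/

section

variable {n : ℕ} {τ : ℂ} {σ : Fin n → ℂ} {lam : Fin n → ℝ} {G : ℂ → ℂ} {μ : ℝ} {κ : ℂ}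

theorem re_pZero_ge (hσ : ∀ k, ‖σ k‖ = 1) (hτσ : ∀ k, τ ≠ σ k) (hlam : ∀ k, lam k < 0)
    (k : Fin n) {z : ℂ} (hz : z ∈ disk) :
    alpha τ σ lam k * (cayley (σ k) z).re ≤ (pZero τ σ lam z).re := by
  simp only [pZero_eq, Complex.re_sum, Complex.re_ofReal_mul]
  exact Finset.single_le_sum (f := fun k => alpha τ σ lam k * (cayley (σ k) z).re)
    (fun j _ => (mul_pos (alpha_pos hτσ hlam j) (re_cayley_pos (hσ j) hz)).le) (Finset.mem_univ k)

theorem re_pZero_pos (hn : 1 ≤ n) (hσ : ∀ k, ‖σ k‖ = 1) (hτσ : ∀ k, τ ≠ σ k)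
    (hlam : ∀ k, lam k < 0) {z : ℂ} (hz : z ∈ disk) : 0 < (pZero τ σ lam z).re :=
  (mul_pos (alpha_pos hτσ hlam ⟨0, hn⟩) (re_cayley_pos (hσ _) hz)).trans_le
    (re_pZero_ge hσ hτσ hlam _ hz)

theorem re_remainder_nonneg (hτ : ‖τ‖ = 1) (hμ : 0 ≤ μ) (hκ : 0 ≤ κ.re) {z : ℂ} (hz : z ∈ disk) :
    0 ≤ (μ * cayley τ z + κ).re := by
  rw [Complex.add_re, Complex.re_ofReal_mul]
  have := re_cayley_pos hτ hz
  positivity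

theorem denominator_ne_zero (hn : 1 ≤ n) (hτ : ‖τ‖ = 1) (hσ : ∀ k, ‖σ k‖ = 1)
    (hτσ : ∀ k, τ ≠ σ k) (hlam : ∀ k, lam k < 0) (hμ : 0 ≤ μ) (hκ : 0 ≤ κ.re) {z : ℂ}
    (hz : z ∈ disk) : pZero τ σ lam z + (μ * cayley τ z + κ) ≠ 0 := by
  intro e
  have h1 := congrArg Complex.re e
  rw [Complex.add_re, Complex.zero_re] at h1
  linarith [re_pZero_pos hn hσ hτσ hlam hz, re_remainder_nonneg hτ hμ hκ hz]

theorem hasBeta_of_eq (hn : 1 ≤ n) (hτ : ‖τ‖ = 1) (hσ : ∀ k, ‖σ k‖ = 1)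
    (hτσ : ∀ k, τ ≠ σ k) (hlam : ∀ k, lam k < 0) (hμ : 0 ≤ μ) (hκ : 0 ≤ κ.re)
    (hG : ∀ z ∈ disk, G z = (τ - z) ^ 2 / (τ * (pZero τ σ lam z + (μ * cayley τ z + κ)))) :
    HasBeta τ G (2 * μ) := by
  have hτ0 := ne_zero_of_norm_eq_one hτ
  refine hasBeta_of_remainder (lam := lam) hτ hτσ (q := fun z => μ * cayley τ z + κ) (fun z hz => ?_) ?_
  · have n1 := denominator_ne_zero hn hτ hσ hτσ hlam hμ hκ hz
    have n2 := sub_ne_zero_of_mem_disk hτ hz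
    rw [hG z hz]
    field_simp
  · have := ((hasAngularLimit_const τ (μ : ℂ)).mul (hasAngularLimit_sub_mul_cayley hτ)).add
      ((hasAngularLimit_id τ).mul (hasAngularLimit_const τ κ))
    rw [zero_mul, add_zero, mul_comm] at this
    exact this.congr fun z _ => by ring

/-- The total mass at `σ k` is `α_k` plus some `m ≥ 0`, and the spectral value is `-|τ - σ_k|² / (2
(m + α_k))`. The bounds need only the sign of `m`, not its value. -/
theorem hasSpectralValue_of_eq (hn : 1 ≤ n) (hτ : ‖τ‖ = 1) (hσ : ∀ k, ‖σ k‖ = 1)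
    (hτσ : ∀ k, τ ≠ σ k) (hlam : ∀ k, lam k < 0) (hμ : 0 ≤ μ) (hκ : 0 ≤ κ.re)
    (hG : ∀ z ∈ disk, G z = (τ - z) ^ 2 / (τ * (pZero τ σ lam z + (μ * cayley τ z + κ))))
    (k : Fin n) : ∃ l : ℝ, HasSpectralValue G (σ k) l ∧ lam k ≤ l ∧ l ≤ 0 := by
  have hτ0 := ne_zero_of_norm_eq_one hτ
  have hσ0 := ne_zero_of_norm_eq_one (hσ k)
  have hα := alpha_pos hτσ hlam k
  obtain ⟨m, hm, hlim, -⟩ := exists_boundary_mass (hσ k)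
    (h := fun z => pZero τ σ lam z + (μ * cayley τ z + κ) - alpha τ σ lam k * cayley (σ k) z)
    (((differentiableOn_sum_cayley hσ _ _).add
      (((differentiableOn_cayley hτ).const_mul _).add_const κ)).sub
      ((differentiableOn_cayley (hσ k)).const_mul _))
    (fun z hz => by
      have h1 := re_pZero_ge hσ hτσ hlam k hz
      have h2 := re_remainder_nonneg hτ hμ hκ hz
      rw [Complex.sub_re, Complex.add_re, Complex.re_ofReal_mul]
      linarith)
  set a := alpha τ σ lam k with ha
  have hma : (0 : ℝ) < m + a := by linarith
  have h1 := hlim.add ((hasAngularLimit_const (σ k) (a : ℂ)).mul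
    (hasAngularLimit_sub_mul_cayley (hσ k)))
  have hne : 2 * σ k * (m : ℂ) + a * (2 * σ k) ≠ 0 := by
    rw [mul_comm (a : ℂ), ← mul_add]
    have : ((m + a : ℝ) : ℂ) ≠ 0 := by exact_mod_cast hma.ne'
    push_cast at this
    exact mul_ne_zero (by simp [hσ0]) this
  have h2 : HasAngularLimit (fun z => (τ - z) ^ 2 / τ) (σ k) ((τ - σ k) ^ 2 / τ) :=
    hasAngularLimit_of_continuousAt (by fun_prop)
  refine ⟨-(‖τ - σ k‖ ^ 2 / (2 * (m + a))), ?_, ?_, ?_⟩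
  · have h3 := h2.mul (h1.inv hne)
    have e : (τ - σ k) ^ 2 / τ * (2 * σ k * (m : ℂ) + a * (2 * σ k))⁻¹ =
        ((-(‖τ - σ k‖ ^ 2 / (2 * (m + a))) : ℝ) : ℂ) := by
      have n1 : (m : ℂ) + a ≠ 0 := by exact_mod_cast hma.ne'
      have h4 := norm_sub_sq_eq hτ (hσ k)
      push_cast at h4 ⊢
      rw [mul_comm (a : ℂ), ← mul_add]
      field_simp
      linear_combination h4
    rw [e] at h3
    refine h3.congr fun z hz => ?_
    have n1 := denominator_ne_zero hn hτ hσ hτσ hlam hμ hκ hz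
    have n2 := sub_ne_zero_of_mem_disk (hσ k) hz
    have e2 : (σ k - z) * (pZero τ σ lam z + (μ * cayley τ z + κ) - a * cayley (σ k) z) +
        a * ((σ k - z) * cayley (σ k) z) =
        (σ k - z) * (pZero τ σ lam z + (μ * cayley τ z + κ)) := by ring
    rw [e2, hG z hz]
    field_simp
  · have h5 : ‖τ - σ k‖ ^ 2 = a * (2 * |lam k|) := by
      have := abs_pos.mpr (hlam k).ne
      rw [ha, alpha, div_mul_cancel₀ _ (by positivity)]
    rw [le_neg, div_le_iff₀ (by positivity), h5, abs_of_neg (hlam k)]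
    nlinarith [hlam k]
  · rw [neg_nonpos]
    positivity

/-- The factor `2` comes from the derivative `(τ - z)² / (2τ)` of `cayleyInv`. The constants `cayley
τ (σ k)`, by which the transforms with poles `σ k` and `τ` differ, are absorbed into `κ`. -/
theorem two_mul_rationalHerglotz_cayley (hτ : ‖τ‖ = 1) (hσ : ∀ k, ‖σ k‖ = 1)
    (hτσ : ∀ k, τ ≠ σ k) {z : ℂ} (hz : z ∈ disk) :
    2 * rationalHerglotz (μ / 2) ((κ - ∑ k, (alpha τ σ lam k : ℂ) * cayley τ (σ k)) / 2)
      (fun k => 2 * alpha τ σ lam k / ‖τ - σ k‖ ^ 2) (fun k => cayley τ (σ k)) (cayley τ z) =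
    pZero τ σ lam z + (μ * cayley τ z + κ) := by
  have h1 : pZero τ σ lam z =
      2 * ∑ k, ((2 * alpha τ σ lam k / ‖τ - σ k‖ ^ 2 : ℝ) : ℂ) * (cayley τ z - cayley τ (σ k))⁻¹ -
        ∑ k, (alpha τ σ lam k : ℂ) * cayley τ (σ k) := by
    rw [pZero_eq, Finset.mul_sum, ← Finset.sum_sub_distrib]
    refine Finset.sum_congr rfl fun k _ => ?_
    rw [cayley_eq_inv_sub hτ (hσ k) (hτσ k) hz]
    push_cast
    ring
  rw [h1, rationalHerglotz]
  push_cast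
  ring

theorem mem_gen_of_eq (hn : 1 ≤ n) (hτ : ‖τ‖ = 1) (hσ : ∀ k, ‖σ k‖ = 1)
    (hτσ : ∀ k, τ ≠ σ k) (hlam : ∀ k, lam k < 0) (hμ : 0 ≤ μ) (hκ : 0 ≤ κ.re)
    (hG : ∀ z ∈ disk, G z = (τ - z) ^ 2 / (τ * (pZero τ σ lam z + (μ * cayley τ z + κ)))) :
    G ∈ Gen τ σ lam := by
  have hτ0 := ne_zero_of_norm_eq_one hτ
  have hA : ∀ k, 0 < 2 * alpha τ σ lam k / ‖τ - σ k‖ ^ 2 := fun k => by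
    have := norm_pos_iff.mpr (sub_ne_zero.mpr (hτσ k))
    have := alpha_pos hτσ hlam k
    positivity
  have hy : ∀ k, (cayley τ (σ k)).re = 0 := fun k => re_cayley_boundary hτ (hσ k)
  -- The shift of `κ` is purely imaginary.
  have hκ' : 0 ≤ ((κ - ∑ k, (alpha τ σ lam k : ℂ) * cayley τ (σ k)) / 2).re := by
    have : (∑ k, (alpha τ σ lam k : ℂ) * cayley τ (σ k)).re = 0 := by
      simp [Complex.re_sum, hy]
    rw [show (2 : ℂ) = ((2 : ℝ) : ℂ) by simp, Complex.div_ofReal_re, Complex.sub_re, this]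
    linarith
  have hK := isKoenigs_rationalHerglotz hn (div_nonneg hμ zero_le_two) hκ' hA hy
  refine ⟨diskFlow τ _, isSemigroup_diskFlow hK hτ, ⟨?_, fun z hz t ht => ?_⟩,
    Or.inr (isDWPoint_diskFlow hK hτ), fun k =>
    ⟨isSemigroupBRFP_diskFlow hK hτ (hσ k) (hτσ k) (hA k) fun v hv => ?_,
      hasSpectralValue_of_eq hn hτ hσ hτσ hlam hμ hκ hG k⟩⟩
  · refine DifferentiableOn.congr (DifferentiableOn.div (by fun_prop)
      (((differentiableOn_sum_cayley hσ _ _).add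
      (((differentiableOn_cayley hτ).const_mul _).add_const κ)).const_mul τ) fun z hz => ?_) hG
    exact mul_ne_zero hτ0 (denominator_ne_zero hn hτ hσ hτσ hlam hμ hκ hz)
  · have hz' := diskFlow_mem hK hτ ht hz
    refine ((hasDerivAt_diskFlow hK hτ ht hz).congr_deriv ?_).hasDerivWithinAt
    rw [hG _ hz', ← two_mul_rationalHerglotz_cayley hτ hσ hτσ hz', ← div_eq_mul_inv, div_div]
    congr 1
    ring
  · have hv' : 0 < v.re := hv
    have hre : ∀ j, 0 ≤ (2 * alpha τ σ lam j / ‖τ - σ j‖ ^ 2) * ((v - cayley τ (σ j))⁻¹).re :=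
      fun j => mul_nonneg (hA j).le (re_inv_nonneg (re_sub_pos hv (hy j)).le)
    have h1 := Finset.single_le_sum (f := fun j =>
      (2 * alpha τ σ lam j / ‖τ - σ j‖ ^ 2) * ((v - cayley τ (σ j))⁻¹).re)
      (fun j _ => hre j) (Finset.mem_univ k)
    simp only [rationalHerglotz, Complex.add_re, Complex.re_ofReal_mul, Complex.re_sum]
    have h2 : 0 ≤ μ / 2 * v.re := by positivity
    linarith

end

end DiskSemigroup

open DiskSemigroup
-- The value region and its extremal functions.
theorem mainTheorem6 (n : ℕ) (hn : 1 ≤ n) (τ : ℂ) (σ : Fin n → ℂ) (lam : Fin n → ℝ)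
    (hτ : ‖τ‖ = 1) (hσ : ∀ k, ‖σ k‖ = 1) (hσinj : Function.Injective σ)
    (hτσ : ∀ k, τ ≠ σ k) (hlam : ∀ k, lam k < 0) :
    (∀ G ∈ Gen τ σ lam, ¬ EqOn G 0 disk → ∃! b : ℝ, HasBeta τ G b) ∧
    valueRegion τ σ lam =
      {p : ℂ × ℝ | p.1 ∈ diskZ τ σ lam \ {0} ∧ 0 ≤ p.2 ∧ p.2 ≤ 2 * (ell τ σ lam p.1).re} ∧
    ∀ ζ ∈ diskZ τ σ lam \ {0},
      (extremalG τ σ lam ζ ∈ Gen τ σ lam ∧ extremalG τ σ lam ζ 0 = ζ ∧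
        HasBeta τ (extremalG τ σ lam ζ) (2 * (ell τ σ lam ζ).re)) ∧
      ∀ G ∈ Gen τ σ lam, G 0 = ζ → HasBeta τ G (2 * (ell τ σ lam ζ).re) →
        EqOn G (extremalG τ σ lam ζ) disk := by
  have hτ0 := ne_zero_of_norm_eq_one hτ
  have hα : 0 < ∑ k, alpha τ σ lam k :=
    Finset.sum_pos (fun k _ => alpha_pos hτσ hlam k) ⟨⟨0, hn⟩, Finset.mem_univ _⟩
  have key : ∀ G ∈ Gen τ σ lam, ¬ EqOn G 0 disk → G 0 ≠ 0 ∧ ∃ m : ℝ, 0 ≤ m ∧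
      HasBeta τ G (2 * m) ∧ m ≤ (ell τ σ lam (G 0)).re ∧
      (m = (ell τ σ lam (G 0)).re → ∀ z ∈ disk, G z = (τ - z) ^ 2 /
        (τ * (pZero τ σ lam z + (m * cayley τ z + (ell τ σ lam (G 0) - m))))) := by
    intro G hG hG0
    obtain ⟨q, hqd, hqre, hq⟩ := exists_remainder_of_mem_gen hτ hσ hσinj hτσ hlam hG hG0
    obtain ⟨m, hm, hlim, hle⟩ := exists_boundary_mass hτ hqd hqre
    have hne := (hq 0 zero_mem_disk).1
    have hq0 : q 0 = ell τ σ lam (G 0) := by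
      have := (hq 0 zero_mem_disk).2
      rw [pZero_zero hσ] at this
      rw [ell, eq_sub_iff_add_eq', ← this]
      field_simp
      ring
    refine ⟨hne, m, hm, hasBeta_of_remainder hτ hτσ (fun z hz => (hq z hz).2) hlim, ?_, ?_⟩
    · simpa [cayley_zero hτ, hq0] using hle 0 zero_mem_disk
    · intro he z hz
      -- In the extremal case the non-negative real part of `q - m · cayley τ` vanishes at `0`,
      -- which determines `q` completely.
      have h1 := eqOn_const_of_re_eq_zero (g := fun z => q z - m * cayley τ z)
        (hqd.sub ((differentiableOn_cayley hτ).const_mul _))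
        (fun z hz => by simpa using hle z hz) zero_mem_disk
        (by simp [cayley_zero hτ, hq0, he]) z hz
      simp only [cayley_zero hτ, mul_one, hq0] at h1
      have h2 := hq z hz
      rw [← h1, add_sub_cancel, ← h2.2]
      have := sub_ne_zero_of_mem_disk hτ hz
      have := h2.1
      field_simp
  -- Taking `κ = ℓ_ζ - m` gives the remainder the value `ℓ_ζ` at `0`, so that `G 0 = ζ`; the
  -- condition `0 ≤ Re κ` is exactly `m ≤ Re ℓ_ζ`.
  have hmem : ∀ ζ : ℂ, ζ ≠ 0 → ∀ m : ℝ, 0 ≤ m → m ≤ (ell τ σ lam ζ).re → ∀ G : ℂ → ℂ,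
      (∀ z ∈ disk, G z = (τ - z) ^ 2 /
        (τ * (pZero τ σ lam z + (m * cayley τ z + (ell τ σ lam ζ - m))))) →
      G ∈ Gen τ σ lam ∧ G 0 = ζ ∧ HasBeta τ G (2 * m) := by
    intro ζ hζ m hm hml G hG
    have hκ : 0 ≤ (ell τ σ lam ζ - m).re := by simpa using hml
    refine ⟨mem_gen_of_eq hn hτ hσ hτσ hlam hm hκ hG, ?_, hasBeta_of_eq hn hτ hσ hτσ hlam hm hκ hG⟩
    have e : (∑ k, (alpha τ σ lam k : ℂ)) + ((m : ℂ) * 1 + (ell τ σ lam ζ - m)) = τ / ζ := by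
      rw [ell]; ring
    rw [hG 0 zero_mem_disk, pZero_zero hσ, cayley_zero hτ, e]
    field_simp
    ring
  have hnot : ∀ G : ℂ → ℂ, G 0 ≠ 0 → ¬ EqOn G 0 disk := fun G h0 h => h0 (h zero_mem_disk)
  have hext : ∀ ζ : ℂ, ∀ z ∈ disk, extremalG τ σ lam ζ z = (τ - z) ^ 2 / (τ * (pZero τ σ lam z +
      (((ell τ σ lam ζ).re : ℂ) * cayley τ z + (ell τ σ lam ζ - ((ell τ σ lam ζ).re : ℂ))))) := by
    intro ζ z hz
    have h1 : ell τ σ lam ζ - ((ell τ σ lam ζ).re : ℂ) = Complex.I * ((ell τ σ lam ζ).im : ℂ) := by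
      rw [sub_eq_iff_eq_add', mul_comm, Complex.re_add_im]
    have h2 : 1 - (starRingEnd ℂ) τ * z = (τ - z) / τ := by
      have : (starRingEnd ℂ) τ = τ⁻¹ := by
        rw [Complex.inv_def, Complex.normSq_eq_norm_sq, hτ]; simp
      rw [this]; field_simp
    rw [h1, extremalG, h2, ← mul_div_assoc, ← pow_two, div_div, cayley]
    congr 2
    ring
  refine ⟨fun G hG hG0 => ?_, ?_, ?_⟩
  · obtain ⟨-, m, -, hb, -⟩ := key G hG hG0
    exact ⟨2 * m, hb, fun b hb' => hb'.unique hτ hb⟩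
  · ext ⟨ζ, b⟩
    constructor
    · rintro ⟨G, hG, hG0, rfl, hb⟩
      obtain ⟨hne, m, hm, hb', hle, -⟩ := key G hG hG0
      have := HasBeta.unique hτ hb hb'
      simp only at this
      refine ⟨⟨(mem_diskZ_iff hτ hα hne).mpr (hm.trans hle), hne⟩, ?_, ?_⟩ <;>
        simp only <;> linarith
    · rintro ⟨⟨hζ, hζ0⟩, hb0, hb⟩
      simp only at hb0 hb hζ hζ0
      -- The mass is `b / 2`, since `β` is twice the mass at `τ`.
      obtain ⟨h1, h2, h3⟩ := hmem ζ hζ0 (b / 2) (by linarith) (by linarith) _ (fun z _ => rfl)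
      refine ⟨_, h1, hnot _ (h2.trans_ne hζ0), h2, ?_⟩
      rwa [mul_div_cancel₀ b two_ne_zero] at h3
  · rintro ζ ⟨hζ, hζ0⟩
    have hl := (mem_diskZ_iff hτ hα hζ0).mp hζ
    refine ⟨hmem ζ hζ0 _ hl le_rfl _ (hext ζ), ?_⟩
    rintro G hG rfl hb z hz
    obtain ⟨-, m, -, hb', -, hm⟩ := key G hG (hnot G hζ0)
    have h1 : m = (ell τ σ lam (G 0)).re := by linarith [HasBeta.unique hτ hb hb']
    rw [hext _ z hz, hm h1 z hz, h1]
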